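/- Let $\mathbf H$ be a complex Hilbert space and let $A\colon\mathfrak D(A)\subseteq\mathbf H\to\mathbf H$ be a self-adjoint operator, possibly unbounded, which is positive definite: there is $c>0$ with $\langle Ax,x\rangle\ge c\|x\|^2$ for all $x\in\mathfrak D(A)$. Let $\mathbf H^2=\mathfrak D(A)$ with inner product $\langle u,v\rangle_2=\langle Au,Av\rangle$, and let $\mathcal H_0=\mathbf H^2\times\mathbf H\times\mathbf H$ with the norm $\|(u,v,\theta)\|^2=\|Au\|^2+\|v\|^2+\|\theta\|^2$. On $\mathcal H_0$ consider the operator $$\mathbb A_0(u,v,\theta)=\bigl(v,\;-A^2u+A\theta,\;-A\theta-Av\bigr)$$ with domain $$\mathfrak D(\mathbb A_0)=\{(u,v,\theta)\in\mathcal H_0:\ v\in\mathfrak D(A),\ -u+A^{-1}\theta\in\mathfrak D(A^2),\ -\theta-v\in\mathfrak D(A)\}=\mathfrak D(A^2)\times\mathfrak D(A)\times\mathfrak D(A),$$ associated with the Euler–Bernoulli thermoelastic plate system $u_{tt}+A^2u-A\theta=0$, $\theta_t+A\theta+Au_t=0$ (coupling exponent $\sigma=1$, no rotational inertia, $\omega=0$).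 Then $\mathbb A_0$ is the infinitesimal generator of a unique $C_0$-semigroup $S_0(t)=e^{t\mathbb A_0}$ on $\mathcal H_0$, this is a semigroup of contractions, and it is analytic: for some $\varphi\in(0,\pi/2]$ there is a family of bounded operators $T(z)$ on $\mathcal H_0$ with $T(t)=S_0(t)$ for $t\ge0$, such that on the sector $\Delta=\{z\neq0:|\arg z|<\varphi\}$ the map $z\mapsto T(z)$ is holomorphic, $T(z+w)=T(z)T(w)$ for $z,w\in\Delta$, and $T(z)U\to U$ as $z\to0$ in $\Delta$, for every $U\in\mathcal H_0$. -/

import Mathlib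

open Filter Topology
open scoped NNReal

noncomputable section

/-! ### `C₀`-semigroups, their generators, and analytic semigroups -/

/-- A `C₀`-semigroup of bounded linear operators on a complex normed space. -/
structure C0Semigroup (E : Type*) [NormedAddCommGroup E] [NormedSpace ℂ E] where
  /-- The operator `S(t)`, `t ≥ 0`. -/
  op : ℝ≥0 → E →L[ℂ] E
  op_zero : op 0 = ContinuousLinearMap.id ℂ E
  op_add : ∀ s t : ℝ≥0, op (s + t) = (op s).comp (op t)
  tendsto_zero : ∀ x : E, Tendsto (fun t : ℝ≥0 => op t x) (𝓝[>] 0) (𝓝 x)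

namespace C0Semigroup

variable {E : Type*} [NormedAddCommGroup E] [NormedSpace ℂ E]

/-- `S(t)` is a contraction for every `t ≥ 0`. -/
def IsContraction (S : C0Semigroup E) : Prop :=
  ∀ t : ℝ≥0, ‖S.op t‖ ≤ 1

/-- The unbounded operator `B` is the infinitesimal generator of `S`: the domain of `B` consists of
exactly those `x` for which `(S(t)x - x)/t` converges as `t ↓ 0`, and `B x` is the limit. -/
def HasGenerator (S : C0Semigroup E) (B : E →ₗ.[ℂ] E) : Prop :=
  ∀ x y : E, (x, y) ∈ B.graph ↔
    Tendsto (fun t : ℝ≥0 => ((t : ℝ) : ℂ)⁻¹ • (S.op t x - x)) (𝓝[>] 0) (𝓝 y)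

/-- The open sector `{z ≠ 0 : |arg z| < φ}`. -/
def sector (φ : ℝ) : Set ℂ := {z : ℂ | z ≠ 0 ∧ |z.arg| < φ}

/-- The semigroup `S` is analytic: it extends from `[0, ∞)` to a holomorphic family (for the
operator norm) on an open sector around the positive half-line, which satisfies the semigroup law
there and converges strongly to the identity as `z → 0` inside the sector. -/
def IsAnalytic (S : C0Semigroup E) : Prop :=
  ∃ φ : ℝ, 0 < φ ∧ φ ≤ Real.pi / 2 ∧ ∃ T : ℂ → E →L[ℂ] E,
    (∀ t : ℝ≥0, T ((t : ℝ) : ℂ) = S.op t) ∧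
    DifferentiableOn ℂ T (sector φ) ∧
    (∀ z ∈ sector φ, ∀ w ∈ sector φ, T (z + w) = (T z).comp (T w)) ∧
    ∀ x : E, Tendsto (fun z : ℂ => T z x) (𝓝[sector φ] 0) (𝓝 x)

end C0Semigroup

/-! ### Positive definite self-adjoint operators and the space `D(A)` -/

/-- A (possibly unbounded) self-adjoint, positive definite operator on a complex Hilbert space. -/
structure PosDefOperator (H : Type*) [NormedAddCommGroup H] [InnerProductSpace ℂ H]
    [CompleteSpace H] where
  /-- The underlying partially defined linear map `A : D(A) ⊆ H → H`. -/
  toPMap : H →ₗ.[ℂ] H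
  selfAdjoint : IsSelfAdjoint toPMap
  posDef : ∃ c : ℝ, 0 < c ∧
    ∀ x : toPMap.domain, c * ‖(x : H)‖ ^ 2 ≤ (inner ℂ (toPMap x) (x : H)).re

namespace PosDefOperator

variable {H : Type*} [NormedAddCommGroup H] [InnerProductSpace ℂ H] [CompleteSpace H]

lemma exists_bound (A : PosDefOperator H) :
    ∃ c : ℝ, 0 < c ∧ ∀ x : A.toPMap.domain, c * ‖(x : H)‖ ≤ ‖A.toPMap x‖ := by
  obtain ⟨c, hc, h⟩ := A.posDef
  refine ⟨c, hc, fun x => ?_⟩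
  have h1 : (inner ℂ (A.toPMap x) (x : H)).re ≤ ‖A.toPMap x‖ * ‖(x : H)‖ :=
    (Complex.re_le_norm _).trans (norm_inner_le_norm _ _)
  have h2 := (h x).trans h1
  rcases (norm_nonneg (x : H)).eq_or_lt with h0 | h0
  · rw [← h0]; simp
  · refine le_of_mul_le_mul_right ?_ h0
    calc c * ‖(x : H)‖ * ‖(x : H)‖ = c * ‖(x : H)‖ ^ 2 := by ring
      _ ≤ _ := h2

lemma eq_zero_of_map_eq_zero (A : PosDefOperator H) (x : A.toPMap.domain)
    (hx : A.toPMap x = 0) : x = 0 := by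
  obtain ⟨c, hc, h⟩ := A.exists_bound
  have h1 := h x
  rw [hx, norm_zero] at h1
  have h2 : ‖(x : H)‖ ≤ 0 := by nlinarith
  exact Subtype.ext (norm_le_zero_iff.1 h2)

lemma map_injective (A : PosDefOperator H) : Function.Injective A.toPMap := by
  intro x y h
  have := A.eq_zero_of_map_eq_zero (x - y) (by rw [LinearPMap.map_sub, h, sub_self])
  exact sub_eq_zero.1 this

/-- The space `D(A)`, to be equipped with the inner product `⟪A u, A v⟫`. -/
def H2 (A : PosDefOperator H) : Type _ := A.toPMap.domain

instance (A : PosDefOperator H) : AddCommGroup A.H2 :=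
  inferInstanceAs (AddCommGroup A.toPMap.domain)

instance (A : PosDefOperator H) : Module ℂ A.H2 :=
  inferInstanceAs (Module ℂ A.toPMap.domain)

/-- The inclusion `D(A) → H`. -/
def incl (A : PosDefOperator H) : A.H2 →ₗ[ℂ] H := A.toPMap.domain.subtype

/-- The map `A : D(A) → H`. -/
def map (A : PosDefOperator H) : A.H2 →ₗ[ℂ] H := A.toPMap.toFun

/-- An element of `H` that lies in `D(A)`, as an element of the space `D(A)`. -/
def mkH2 (A : PosDefOperator H) (x : H) (hx : x ∈ A.toPMap.domain) : A.H2 :=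
  (⟨x, hx⟩ : A.toPMap.domain)

/-- The inner product `⟪u, v⟫₂ = ⟪A u, A v⟫` on `D(A)`. -/
@[reducible] def core (A : PosDefOperator H) : InnerProductSpace.Core ℂ A.H2 where
  inner u v := inner ℂ (A.map u) (A.map v)
  conj_inner_symm u v := inner_conj_symm _ _
  re_inner_nonneg u := inner_self_nonneg
  add_left u v w := by rw [map_add, inner_add_left]
  smul_left u v r := by rw [map_smul, inner_smul_left]
  definite u h := A.eq_zero_of_map_eq_zero u (inner_self_eq_zero.1 h)

instance (A : PosDefOperator H) : NormedAddCommGroup A.H2 :=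
  A.core.toNormedAddCommGroup

instance (A : PosDefOperator H) : InnerProductSpace ℂ A.H2 :=
  InnerProductSpace.ofCore A.core.toCore

lemma inner_H2 (A : PosDefOperator H) (u v : A.H2) :
    inner ℂ u v = inner ℂ (A.map u) (A.map v) := rfl

lemma norm_H2 (A : PosDefOperator H) (u : A.H2) : ‖u‖ = ‖A.map u‖ := by
  rw [@norm_eq_sqrt_re_inner ℂ, @norm_eq_sqrt_re_inner ℂ, inner_H2]

instance (A : PosDefOperator H) : CompleteSpace A.H2 := by
  refine Metric.complete_of_cauchySeq_tendsto fun u hu => ?_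
  obtain ⟨c, hc, hb⟩ := A.exists_bound
  have hmap : CauchySeq fun n => A.map (u n) := by
    rw [Metric.cauchySeq_iff] at hu ⊢
    intro ε hε
    obtain ⟨N, hN⟩ := hu ε hε
    refine ⟨N, fun m hm n hn => ?_⟩
    have := hN m hm n hn
    rwa [dist_eq_norm, norm_H2, map_sub, ← dist_eq_norm] at this
  have hincl : CauchySeq fun n => A.incl (u n) := by
    rw [Metric.cauchySeq_iff] at hu ⊢
    intro ε hε
    obtain ⟨N, hN⟩ := hu (c * ε) (by positivity)
    refine ⟨N, fun m hm n hn => ?_⟩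
    have h1 := hN m hm n hn
    rw [dist_eq_norm, norm_H2] at h1
    have h2 : c * ‖A.incl (u m - u n)‖ ≤ ‖A.map (u m - u n)‖ := hb (u m - u n)
    rw [map_sub, ← dist_eq_norm] at h2
    exact lt_of_mul_lt_mul_left (h2.trans_lt h1) hc.le
  obtain ⟨y, hy⟩ := cauchySeq_tendsto_of_complete hmap
  obtain ⟨x, hx⟩ := cauchySeq_tendsto_of_complete hincl
  have hcl : IsClosed (A.toPMap.graph : Set (H × H)) := A.selfAdjoint.isClosed
  have hxy : (x, y) ∈ A.toPMap.graph :=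
    hcl.mem_of_tendsto (hx.prodMk_nhds hy)
      (Eventually.of_forall fun n => A.toPMap.mem_graph (u n))
  obtain ⟨w, hw1, hw2⟩ := (LinearPMap.mem_graph_iff _).1 hxy
  let w' : A.H2 := w
  have hw' : A.map w' = y := hw2
  refine ⟨w', ?_⟩
  rw [tendsto_iff_norm_sub_tendsto_zero]
  have h3 : ∀ n, ‖u n - w'‖ = ‖A.map (u n) - y‖ := by
    intro n
    rw [norm_H2, map_sub, hw']
  simp_rw [h3]
  exact tendsto_iff_norm_sub_tendsto_zero.1 hy

lemma map_surjective (A : PosDefOperator H) : Function.Surjective A.map := by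
  let L : A.H2 →ₗᵢ[ℂ] H := ⟨A.map, fun u => (A.norm_H2 u).symm⟩
  have hcl : IsClosed (A.map.range : Set H) := by
    have : IsClosed (Set.range L) := L.isometry.isClosedEmbedding.isClosed_range
    rwa [LinearMap.coe_range]
  have hperp : (A.map.range)ᗮ = ⊥ := by
    rw [Submodule.eq_bot_iff]
    intro y hy
    have hy' : ∀ x : A.toPMap.domain, inner ℂ (0 : H) (x : H) = inner ℂ y (A.toPMap x) := by
      intro x
      rw [inner_zero_left]
      exact ((Submodule.mem_orthogonal' _ _).1 hy _ ⟨(x : A.H2), rfl⟩).symm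
    have hstar : A.toPMap.adjoint = A.toPMap := A.selfAdjoint
    have hd : y ∈ A.toPMap.adjoint.domain :=
      LinearPMap.mem_adjoint_domain_of_exists y ⟨0, hy'⟩
    have h0 : A.toPMap.adjoint ⟨y, hd⟩ = 0 :=
      LinearPMap.adjoint_apply_eq A.selfAdjoint.dense_domain ⟨y, hd⟩ hy'
    have hg : (y, (0 : H)) ∈ A.toPMap.graph := by
      rw [← hstar, ← h0]
      exact A.toPMap.adjoint.mem_graph ⟨y, hd⟩
    obtain ⟨w, hw1, hw2⟩ := (LinearPMap.mem_graph_iff _).1 hg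
    have hw0 := A.eq_zero_of_map_eq_zero w hw2
    rw [hw0] at hw1
    exact hw1.symm
  have htop : A.map.range = ⊤ := by
    have : CompleteSpace A.map.range := hcl.completeSpace_coe
    exact Submodule.orthogonal_eq_bot_iff.1 hperp
  intro y
  have : y ∈ A.map.range := by rw [htop]; trivial
  exact this

/-- The inverse `A⁻¹ : H → D(A)`. -/
def inv (A : PosDefOperator H) : H →ₗ[ℂ] A.H2 :=
  (LinearEquiv.ofBijective A.map ⟨A.map_injective, A.map_surjective⟩).symm.toLinearMap

lemma map_inv (A : PosDefOperator H) (x : H) : A.map (A.inv x) = x :=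
  (LinearEquiv.ofBijective A.map ⟨A.map_injective, A.map_surjective⟩).apply_symm_apply x

/-! ### The Euler-Bernoulli thermoelastic plate -/

/-- The phase space `D(A) × H × H`, with the norm
`‖(u, v, θ)‖² = ‖A u‖² + ‖v‖² + ‖θ‖²`. -/
abbrev PhaseSpace (A : PosDefOperator H) : Type _ :=
  WithLp 2 (A.H2 × WithLp 2 (H × H))

lemma norm_sq_phaseSpace (A : PosDefOperator H) (U : A.PhaseSpace) :
    ‖U‖ ^ 2 = ‖A.map U.fst‖ ^ 2 + ‖U.snd.fst‖ ^ 2 + ‖U.snd.snd‖ ^ 2 := by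
  rw [WithLp.prod_norm_sq_eq_of_L2, WithLp.prod_norm_sq_eq_of_L2, norm_H2, add_assoc]

lemma toPMap_eq_add (A : PosDefOperator H) {x y z : H} (hx : x ∈ A.toPMap.domain)
    (hy : y ∈ A.toPMap.domain) (hz : z ∈ A.toPMap.domain) (h : z = x + y) :
    A.toPMap ⟨z, hz⟩ = A.toPMap ⟨x, hx⟩ + A.toPMap ⟨y, hy⟩ := by
  subst h
  rw [← LinearPMap.map_add]
  rfl

lemma toPMap_eq_smul (A : PosDefOperator H) (c : ℂ) {x z : H} (hx : x ∈ A.toPMap.domain)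
    (hz : z ∈ A.toPMap.domain) (h : z = c • x) :
    A.toPMap ⟨z, hz⟩ = c • A.toPMap ⟨x, hx⟩ := by
  subst h
  rw [← LinearPMap.map_smul]
  rfl

/-- The subspace `D(A²) × D(A) × D(A)` of the phase space. -/
def plateDomain (A : PosDefOperator H) : Submodule ℂ A.PhaseSpace where
  carrier := {U | A.map U.fst ∈ A.toPMap.domain ∧ U.snd.fst ∈ A.toPMap.domain ∧
    U.snd.snd ∈ A.toPMap.domain}
  zero_mem' := by simp
  add_mem' := fun {U V} hU hV => by
    refine ⟨?_, add_mem hU.2.1 hV.2.1, add_mem hU.2.2 hV.2.2⟩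
    change A.map (U.fst + V.fst) ∈ _
    rw [map_add]
    exact add_mem hU.1 hV.1
  smul_mem' := fun c U hU => by
    refine ⟨?_, Submodule.smul_mem _ c hU.2.1, Submodule.smul_mem _ c hU.2.2⟩
    change A.map (c • U.fst) ∈ _
    rw [map_smul]
    exact Submodule.smul_mem _ c hU.1

/-- The operator `𝔸₀ (u, v, θ) = (v, -A² u + A θ, -A θ - A v)` of the thermoelastic plate system
`u'' + A² u - A θ = 0`, `θ' + A θ + A u' = 0`, with domain `D(A²) × D(A) × D(A)`. -/
def plate (A : PosDefOperator H) : A.PhaseSpace →ₗ.[ℂ] A.PhaseSpace where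
  domain := A.plateDomain
  toFun :=
    { toFun := fun U => WithLp.toLp 2
        (A.mkH2 U.1.snd.fst U.2.2.1,
          WithLp.toLp 2
            (-A.toPMap ⟨A.map U.1.fst, U.2.1⟩ + A.toPMap ⟨U.1.snd.snd, U.2.2.2⟩,
             -A.toPMap ⟨U.1.snd.snd, U.2.2.2⟩ - A.toPMap ⟨U.1.snd.fst, U.2.2.1⟩))
      map_add' := fun U V => by
        rw [A.toPMap_eq_add U.2.1 V.2.1 (U + V).2.1 (map_add A.map U.1.fst V.1.fst),
          A.toPMap_eq_add U.2.2.1 V.2.2.1 (U + V).2.2.1 rfl,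
          A.toPMap_eq_add U.2.2.2 V.2.2.2 (U + V).2.2.2 rfl]
        refine WithLp.ofLp_injective 2 (Prod.ext rfl (WithLp.ofLp_injective 2 (Prod.ext ?_ ?_)))
        · exact (by intros; abel : ∀ a b c d : H, -(a + b) + (c + d) = (-a + c) + (-b + d)) _ _ _ _
        · exact (by intros; abel : ∀ a b c d : H, -(a + b) - (c + d) = (-a - c) + (-b - d)) _ _ _ _
      map_smul' := fun c U => by
        rw [A.toPMap_eq_smul c U.2.1 (c • U).2.1 (map_smul A.map c U.1.fst),
          A.toPMap_eq_smul c U.2.2.1 (c • U).2.2.1 rfl,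
          A.toPMap_eq_smul c U.2.2.2 (c • U).2.2.2 rfl]
        refine WithLp.ofLp_injective 2 (Prod.ext rfl (WithLp.ofLp_injective 2 (Prod.ext ?_ ?_)))
        · exact (by intro a b; rw [smul_add, smul_neg] :
            ∀ a b : H, -(c • a) + c • b = c • (-a + b)) _ _
        · exact (by intro a b; rw [smul_sub, smul_neg] :
            ∀ a b : H, -(c • a) - c • b = c • (-a - b)) _ _ }

/-- The domain of `𝔸₀` is also described by the conditions `v ∈ D(A)`,
`-u + A⁻¹ θ ∈ D(A²)` and `-θ - v ∈ D(A)`. -/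
lemma mem_plate_domain_iff (A : PosDefOperator H) (U : A.PhaseSpace) :
    U ∈ A.plate.domain ↔
      U.snd.fst ∈ A.toPMap.domain ∧
      A.map (-U.fst + A.inv U.snd.snd) ∈ A.toPMap.domain ∧
      -U.snd.snd - U.snd.fst ∈ A.toPMap.domain := by
  change (A.map U.fst ∈ A.toPMap.domain ∧ U.snd.fst ∈ A.toPMap.domain ∧
    U.snd.snd ∈ A.toPMap.domain) ↔ _
  rw [map_add, map_neg, map_inv]
  constructor
  · rintro ⟨h1, h2, h3⟩
    exact ⟨h2, add_mem (neg_mem h1) h3, sub_mem (neg_mem h3) h2⟩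
  · rintro ⟨h2, h1, h3⟩
    have h4 : U.snd.snd ∈ A.toPMap.domain := by
      have := neg_mem (add_mem h3 h2)
      simpa using this
    refine ⟨?_, h2, h4⟩
    have := sub_mem h4 h1
    simpa using this

end PosDefOperator

end

/-!
The plate operator is `𝔸₀ = R⁻¹ M` on the phase space, where `R = phaseInv` is the componentwise
action of `A⁻¹`, a bounded injective operator with `0 ≤ R`, and `M = phaseCoupling` is the bounded
operator `(u, v, θ) ↦ (A⁻¹ v, -A u + θ, -θ - v)`. After the identification of `D(A)` with the
ambient space through `A`, the operator `M` is the matrix `!![0, 1, 0; -1, 0, 1; 0, -1, -1]`; in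
particular it commutes with `R` and satisfies the cubic equation `M³ + M² + 2 M + 1 = 0`
(`PosDefOperator.phaseCoupling_cubic`, `PosDefOperator.mem_graph_plate_iff`).

The cubic has three distinct roots `μᵢ` with `Re μᵢ < 0` (`exists_plate_eigenvalues`), so Lagrange
interpolation gives projections `Eᵢ` with `∑ Eᵢ = 1` and `M Eᵢ = μᵢ Eᵢ`, and the semigroup has to be
`exp (z 𝔸₀) = ∑ Eᵢ exp (z μᵢ R⁻¹)`. The operators `exp (-w R⁻¹)` with `0 < Re w` come from the
continuous functional calculus of `R`, applied to `x ↦ exp (-w / x)`, which extends continuously by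
`0` to `x = 0`. Scalar estimates, uniform on `[0, ∞)`, show that they are contractions, are
holomorphic in `w` for the operator norm (`hasDerivAt_heat`), and have the right behaviour as
`w → 0` (`tendsto_heat_apply`, `tendsto_heat_slope`). The map `z ↦ -μᵢ z` sends a small enough
sector around the positive half-line into the right half-plane for each of the finitely many `i`, whence
the analyticity.

Contractivity and uniqueness follow from `Re ⟪𝔸₀ U, U⟫ ≤ 0`
(`PosDefOperator.re_inner_phaseCoupling_phaseInv_nonpos`): the norm of a solution of `U' = 𝔸₀ U`
does not increase, which applies to an orbit and to the difference of the orbits of two semigroups with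
the generator `𝔸₀`. For an arbitrary semigroup this needs the continuity of its orbits
(`C0Semigroup.continuous_op_apply`), a consequence of the uniform boundedness principle.
-/

/-! ### `C₀`-semigroups and dissipative generators -/

noncomputable section

namespace C0Semigroup

variable {E : Type*} [NormedAddCommGroup E] [NormedSpace ℂ E]

lemma op_add_apply (S : C0Semigroup E) (s t : ℝ≥0) (x : E) :
    S.op (s + t) x = S.op s (S.op t x) := by
  rw [S.op_add]; rfl

@[ext]
lemma ext {S T : C0Semigroup E} (h : ∀ t x, S.op t x = T.op t x) : S = T := by
  have hop : S.op = T.op := funext fun t => ContinuousLinearMap.ext (h t)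
  cases S
  cases T
  congr

lemma tendsto_nhds_zero (S : C0Semigroup E) (x : E) :
    Tendsto (fun t : ℝ≥0 => S.op t x) (𝓝 0) (𝓝 x) := by
  have h : (𝓝 (0 : ℝ≥0)) = 𝓝[>] 0 ⊔ pure 0 := by
    rw [sup_comm, ← nhdsNE_sup_pure, sup_comm]
    congr 2
    ext t
    simp [pos_iff_ne_zero]
  rw [h, tendsto_sup]
  refine ⟨S.tendsto_zero x, ?_⟩
  rw [tendsto_pure_left]
  intro s hs
  simpa [S.op_zero] using mem_of_mem_nhds hs

/-- A `C₀`-semigroup is bounded near `0`: otherwise some sequence `S(tₙ)` with `tₙ → 0` is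
unbounded in norm, although `S(tₙ)x` converges for every `x`, against the uniform boundedness
principle. -/
lemma exists_norm_le_near_zero [CompleteSpace E] (S : C0Semigroup E) :
    ∃ δ : ℝ≥0, 0 < δ ∧ ∃ C : ℝ, ∀ t ≤ δ, ‖S.op t‖ ≤ C := by
  by_contra! hcon
  have h (n : ℕ) : ∃ t ≤ (1 / ((n : ℝ≥0) + 1)), (n : ℝ) < ‖S.op t‖ :=
    hcon _ (by positivity) n
  choose t ht htn using h
  have ht0 : Tendsto t atTop (𝓝 0) :=
    tendsto_of_tendsto_of_tendsto_of_le_of_le tendsto_const_nhds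
      (tendsto_one_div_add_atTop_nhds_zero_nat (𝕜 := ℝ≥0)) (fun _ => zero_le) ht
  obtain ⟨C, hC⟩ := banach_steinhaus (g := fun n => S.op (t n)) fun x => by
    obtain ⟨C, hC⟩ := (((S.tendsto_nhds_zero x).comp ht0).norm).bddAbove_range
    exact ⟨C, fun n => hC ⟨n, rfl⟩⟩
  obtain ⟨n, hn⟩ := exists_nat_gt C
  exact absurd (hC n) (not_le.2 (hn.trans (htn n)))

lemma exists_norm_le [CompleteSpace E] (S : C0Semigroup E) (τ : ℝ≥0) :
    ∃ C : ℝ, ∀ t ≤ τ, ‖S.op t‖ ≤ C := by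
  obtain ⟨δ, hδ, C, hC⟩ := S.exists_norm_le_near_zero
  have key : ∀ n : ℕ, ∃ D : ℝ, ∀ t ≤ n * δ, ‖S.op t‖ ≤ D := by
    intro n
    induction n with
    | zero => exact ⟨C, fun t ht => hC t (le_trans (by simpa using ht) hδ.le)⟩
    | succ n ih =>
      obtain ⟨D, hD⟩ := ih
      refine ⟨C * D, fun t ht => ?_⟩
      have hsplit : t = min t δ + (t - δ) := by
        rcases le_total t δ with h | h
        · simp [h, tsub_eq_zero_of_le h]
        · simp [h]
      rw [hsplit, S.op_add]
      refine (ContinuousLinearMap.opNorm_comp_le _ _).trans ?_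
      refine mul_le_mul (hC _ (min_le_right _ _)) (hD _ ?_) (norm_nonneg _)
        ((norm_nonneg _).trans (hC 0 hδ.le))
      rw [tsub_le_iff_right]
      simpa [add_mul] using ht
  obtain ⟨n, hn⟩ := exists_nat_gt (τ / δ)
  obtain ⟨D, hD⟩ := key n
  refine ⟨D, fun t ht => hD t (ht.trans ?_)⟩
  rw [div_lt_iff₀ hδ] at hn
  exact hn.le

lemma continuous_op_apply [CompleteSpace E] (S : C0Semigroup E) (x : E) :
    Continuous fun t : ℝ≥0 => S.op t x := by
  refine continuous_iff_continuousAt.2 fun t₀ => ?_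
  obtain ⟨C, hC⟩ := S.exists_norm_le (t₀ + 1)
  -- In `ℝ≥0` the truncated sum `(s - t₀) + (t₀ - s)` is `|s - t₀|`.
  have hdist : Tendsto (fun s : ℝ≥0 => (s - t₀) + (t₀ - s)) (𝓝 t₀) (𝓝 0) := by
    have : Continuous fun s : ℝ≥0 => (s - t₀) + (t₀ - s) := by fun_prop
    simpa using this.tendsto t₀
  have hlim : Tendsto (fun s : ℝ≥0 => C * ‖S.op ((s - t₀) + (t₀ - s)) x - x‖) (𝓝 t₀) (𝓝 0) := by
    have := (((S.tendsto_nhds_zero x).comp hdist).sub_const x).norm.const_mul C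
    simpa using this
  refine tendsto_iff_norm_sub_tendsto_zero.2 (squeeze_zero' (.of_forall fun _ => norm_nonneg _)
    ?_ hlim)
  filter_upwards [Iic_mem_nhds (show t₀ < t₀ + 1 by simp)] with s hs
  rcases le_total t₀ s with h | h
  · have h1 : S.op s x - S.op t₀ x = S.op t₀ (S.op (s - t₀) x - x) := by
      rw [map_sub, ← op_add_apply, add_tsub_cancel_of_le h]
    rw [h1, tsub_eq_zero_of_le h, add_zero]
    exact (S.op t₀).le_of_opNorm_le (hC _ (by simp)) _
  · have h1 : S.op s x - S.op t₀ x = -S.op s (S.op (t₀ - s) x - x) := by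
      rw [map_sub, ← op_add_apply, add_tsub_cancel_of_le h]
      abel
    rw [h1, tsub_eq_zero_of_le h, zero_add, norm_neg]
    exact (S.op s).le_of_opNorm_le (hC _ hs) _

variable {S : C0Semigroup E} {B : E →ₗ.[ℂ] E}

lemma HasGenerator.tendsto_op (h : S.HasGenerator B) {x y : E} (hxy : (x, y) ∈ B.graph)
    (t : ℝ≥0) :
    Tendsto (fun r : ℝ≥0 => ((r : ℝ) : ℂ)⁻¹ • (S.op (t + r) x - S.op t x)) (𝓝[>] 0)
      (𝓝 (S.op t y)) := by
  have := ((S.op t).continuous.tendsto y).comp ((h x y).1 hxy)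
  refine this.congr fun r => ?_
  simp [op_add_apply]

/-- A semigroup commutes with its generator. -/
lemma HasGenerator.op_mem_graph (h : S.HasGenerator B) {x y : E} (hxy : (x, y) ∈ B.graph)
    (t : ℝ≥0) : (S.op t x, S.op t y) ∈ B.graph := by
  refine (h _ _).2 ((h.tendsto_op hxy t).congr fun r => ?_)
  rw [add_comm t r, op_add_apply]

lemma HasGenerator.hasDerivWithinAt (h : S.HasGenerator B) {x y : E} (hxy : (x, y) ∈ B.graph)
    {t : ℝ} (ht : 0 ≤ t) :
    HasDerivWithinAt (fun s : ℝ => S.op s.toNNReal x) (S.op t.toNNReal y) (Set.Ici t) t := by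
  rw [← hasDerivWithinAt_Ioi_iff_Ici, hasDerivWithinAt_iff_tendsto_slope' (by simp)]
  have hshift : Tendsto (fun s : ℝ => (s - t).toNNReal) (𝓝[>] t) (𝓝[>] 0) := by
    refine tendsto_nhdsWithin_iff.2 ⟨?_, ?_⟩
    · have : Continuous fun s : ℝ => (s - t).toNNReal := by fun_prop
      simpa using (this.tendsto t).mono_left nhdsWithin_le_nhds
    · filter_upwards [self_mem_nhdsWithin] with s hs
      simpa using hs
  refine ((h.tendsto_op hxy t.toNNReal).comp hshift).congr' ?_
  filter_upwards [self_mem_nhdsWithin] with s hs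
  have hs' : t < s := hs
  have h1 : t.toNNReal + (s - t).toNNReal = s.toNNReal := by
    rw [← Real.toNNReal_add ht (sub_nonneg.2 hs'.le), add_sub_cancel]
  simp only [Function.comp_apply, slope_def_module]
  rw [h1, Real.coe_toNNReal _ (sub_nonneg.2 hs'.le), ← Complex.ofReal_inv, Complex.coe_smul]

end C0Semigroup

section Dissipative

variable {K : Type*} [NormedAddCommGroup K] [InnerProductSpace ℂ K]

/-- Along a solution of `u' = B u` with `B` dissipative the norm does not increase. -/
lemma norm_le_of_dissipative {u u' : ℝ → K} (hu : Continuous u)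
    (hderiv : ∀ t, 0 ≤ t → HasDerivWithinAt u (u' t) (Set.Ici t) t)
    (hdiss : ∀ t, 0 ≤ t → (inner ℂ (u' t) (u t)).re ≤ 0) {t : ℝ} (ht : 0 ≤ t) :
    ‖u t‖ ≤ ‖u 0‖ := by
  have hsq : ∀ s, (inner ℂ (u s) (u s)).re = ‖u s‖ ^ 2 := fun s => inner_self_eq_norm_sq (𝕜 := ℂ) _
  have hd : ∀ s ∈ Set.Ico 0 t, HasDerivWithinAt (fun r => (inner ℂ (u r) (u r)).re)
      ((inner ℂ (u s) (u' s) + inner ℂ (u' s) (u s)).re) (Set.Ici s) s := fun s hs =>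
    Complex.reCLM.hasFDerivAt.comp_hasDerivWithinAt s
      ((hderiv s hs.1).inner ℂ (hderiv s hs.1))
  have hle := image_le_of_deriv_right_le_deriv_boundary
    (f := fun r => (inner ℂ (u r) (u r)).re)
    (Complex.continuous_re.comp (hu.inner hu)).continuousOn hd
    (B := fun _ => ‖u 0‖ ^ 2) (B' := fun _ => 0) (hsq 0).le continuousOn_const
    (fun s _ => hasDerivWithinAt_const _ _ _)
    (fun s hs => by
      have h1 := hdiss s hs.1
      have h2 : (inner ℂ (u s) (u' s)).re = (inner ℂ (u' s) (u s)).re :=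
        inner_re_symm (𝕜 := ℂ) _ _
      rw [Complex.add_re, h2]
      linarith)
    (Set.right_mem_Icc.2 ht)
  rw [hsq] at hle
  exact le_of_sq_le_sq hle (norm_nonneg _)

namespace C0Semigroup

variable {B : K →ₗ.[ℂ] K} {S T : C0Semigroup K} [CompleteSpace K]

lemma HasGenerator.isContraction (hS : S.HasGenerator B) (hB : Dense (B.domain : Set K))
    (hdiss : ∀ x y, (x, y) ∈ B.graph → (inner ℂ y x).re ≤ 0) : S.IsContraction := by
  intro t
  refine ContinuousLinearMap.opNorm_le_bound _ zero_le_one fun x => ?_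
  rw [one_mul]
  refine hB.induction (P := fun x => ‖S.op t x‖ ≤ ‖x‖) (fun x hx => ?_)
    (isClosed_le (S.op t).continuous.norm continuous_norm) x
  have hxy : (x, B ⟨x, hx⟩) ∈ B.graph := B.mem_graph ⟨x, hx⟩
  have := norm_le_of_dissipative ((S.continuous_op_apply x).comp continuous_real_toNNReal)
    (fun s hs => hS.hasDerivWithinAt hxy hs)
    (fun s hs => hdiss _ _ (hS.op_mem_graph hxy _)) t.2
  simpa [S.op_zero] using this

/-- Two semigroups with the same dissipative generator `B` agree: for `x ∈ D(B)` the difference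
`T(t)x - S(t)x` solves `u' = B u` with `u(0) = 0`. -/
lemma HasGenerator.unique (hS : S.HasGenerator B) (hT : T.HasGenerator B)
    (hB : Dense (B.domain : Set K))
    (hdiss : ∀ x y, (x, y) ∈ B.graph → (inner ℂ y x).re ≤ 0) : T = S := by
  ext t x
  refine hB.induction (P := fun x => T.op t x = S.op t x) (fun x hx => ?_)
    (isClosed_eq (T.op t).continuous (S.op t).continuous) x
  have hxy : (x, B ⟨x, hx⟩) ∈ B.graph := B.mem_graph ⟨x, hx⟩
  have := norm_le_of_dissipative
    (((T.continuous_op_apply x).comp continuous_real_toNNReal).sub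
      ((S.continuous_op_apply x).comp continuous_real_toNNReal))
    (fun s hs => (hT.hasDerivWithinAt hxy hs).sub (hS.hasDerivWithinAt hxy hs))
    (fun s hs => hdiss _ _
      (B.graph.sub_mem (hT.op_mem_graph hxy _) (hS.op_mem_graph hxy _))) t.2
  simpa [S.op_zero, T.op_zero, sub_eq_zero] using this

end C0Semigroup

end Dissipative

/-! ### The holomorphic semigroup of the inverse of a nonnegative operator -/

section ScalarEstimates

lemma Complex.norm_exp_neg_sub_one_le {u : ℂ} (hu : 0 ≤ u.re) : ‖Complex.exp (-u) - 1‖ ≤ ‖u‖ := by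
  have hd : ∀ z ∈ {z : ℂ | 0 ≤ z.re},
      HasDerivWithinAt (fun z => Complex.exp (-z)) (Complex.exp (-z) * -1) {z : ℂ | 0 ≤ z.re} z :=
    fun z _ => ((hasDerivAt_neg z).cexp).hasDerivWithinAt
  have := Convex.norm_image_sub_le_of_norm_hasDerivWithin_le (C := 1) (x := 0) (y := u) hd
    (fun z hz => by
      have hz' : 0 ≤ z.re := hz
      simpa [Complex.norm_exp] using hz')
    (convex_halfSpace_re_ge 0) (by simp) hu
  simpa using this

lemma Complex.norm_exp_neg_sub_one_add_le {u : ℂ} (hu : 0 ≤ u.re) :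
    ‖Complex.exp (-u) - 1 + u‖ ≤ ‖u‖ ^ 2 := by
  have hd : ∀ z ∈ {z : ℂ | 0 ≤ z.re} ∩ Metric.closedBall 0 ‖u‖,
      HasDerivWithinAt (fun z => Complex.exp (-z) - 1 + z) (Complex.exp (-z) * -1 + 1)
        ({z : ℂ | 0 ≤ z.re} ∩ Metric.closedBall 0 ‖u‖) z :=
    fun z _ => ((((hasDerivAt_neg z).cexp).sub_const 1).add (hasDerivAt_id z)).hasDerivWithinAt
  have := Convex.norm_image_sub_le_of_norm_hasDerivWithin_le (C := ‖u‖) (x := 0) (y := u) hd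
    (fun z hz => by
      have h1 := Complex.norm_exp_neg_sub_one_le hz.1
      have h2 : ‖z‖ ≤ ‖u‖ := by simpa using hz.2
      have h3 : Complex.exp (-z) * -1 + 1 = -(Complex.exp (-z) - 1) := by ring
      rw [h3, norm_neg]
      exact h1.trans h2)
    ((convex_halfSpace_re_ge 0).inter (convex_closedBall _ _)) (by simp) ⟨hu, by simp⟩
  simpa [sq] using this

lemma Real.sq_mul_exp_neg_le {b s : ℝ} (hb : 0 < b) (hs : 0 ≤ s) :
    s ^ 2 * Real.exp (-(b * s)) ≤ 2 / b ^ 2 := by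
  have h1 := Real.quadratic_le_exp_of_nonneg (x := b * s) (by positivity)
  rw [Real.exp_neg, ← div_eq_mul_inv, div_le_div_iff₀ (Real.exp_pos _) (by positivity)]
  nlinarith [mul_nonneg hb.le hs]

/-- The function `z ↦ exp (-w / z)`, with the value `0` at `z = 0`, which makes it continuous on
`[0, ∞)` when `0 < Re w`. -/
def expNegDiv (w z : ℂ) : ℂ := if z = 0 then 0 else Complex.exp (-(w / z))

@[simp]
lemma expNegDiv_zero_right (w : ℂ) : expNegDiv w 0 = 0 := if_pos rfl

lemma expNegDiv_of_ne {z : ℂ} (w : ℂ) (hz : z ≠ 0) : expNegDiv w z = Complex.exp (-(w / z)) :=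
  if_neg hz

lemma norm_expNegDiv_ofReal (w : ℂ) {x : ℝ} (hx : 0 < x) :
    ‖expNegDiv w x‖ = Real.exp (-(w.re * x⁻¹)) := by
  rw [expNegDiv_of_ne _ (by exact_mod_cast hx.ne'), Complex.norm_exp, Complex.neg_re,
    Complex.div_ofReal_re, div_eq_mul_inv]

lemma norm_expNegDiv_le_mul {w : ℂ} (hw : 0 < w.re) {x : ℝ} (hx : 0 < x) :
    ‖expNegDiv w x‖ ≤ w.re⁻¹ * x := by
  rw [norm_expNegDiv_ofReal w hx, Real.exp_neg, ← inv_inv x, ← mul_inv, inv_inv]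
  have hpos : 0 < w.re * x⁻¹ := by positivity
  exact inv_anti₀ hpos (by linarith [Real.add_one_le_exp (w.re * x⁻¹)])

lemma norm_expNegDiv_le_one {w : ℂ} (hw : 0 ≤ w.re) {x : ℝ} (hx : 0 ≤ x) :
    ‖expNegDiv w x‖ ≤ 1 := by
  rcases hx.eq_or_lt with rfl | hx
  · simp
  · rw [norm_expNegDiv_ofReal w hx, Real.exp_le_one_iff, neg_nonpos]
    positivity

lemma continuousAt_expNegDiv (w : ℂ) {z : ℂ} (hz : z ≠ 0) : ContinuousAt (expNegDiv w) z := by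
  have h1 : ContinuousAt (fun z => Complex.exp (-(w / z))) z := by fun_prop (disch := assumption)
  refine h1.congr ?_
  filter_upwards [isOpen_ne.mem_nhds hz] with y hy
  exact (expNegDiv_of_ne w hy).symm

lemma expNegDiv_mul (w₁ w₂ z : ℂ) :
    expNegDiv w₁ z * expNegDiv w₂ z = expNegDiv (w₁ + w₂) z := by
  rcases eq_or_ne z 0 with rfl | hz
  · simp
  · rw [expNegDiv_of_ne _ hz, expNegDiv_of_ne _ hz, expNegDiv_of_ne _ hz, ← Complex.exp_add]
    ring_nf

lemma norm_expNegDiv_mul_sub_le {w : ℂ} (hw : 0 ≤ w.re) {x : ℝ} (hx : 0 ≤ x) :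
    ‖expNegDiv w x * x - x‖ ≤ ‖w‖ := by
  rcases hx.eq_or_lt with rfl | hx
  · simp
  have hx' : (x : ℂ) ≠ 0 := by exact_mod_cast hx.ne'
  have h1 := Complex.norm_exp_neg_sub_one_le (u := w / x)
    (by rw [Complex.div_ofReal_re]; positivity)
  rw [norm_div, Complex.norm_of_nonneg hx.le, le_div_iff₀ hx] at h1
  have h2 : expNegDiv w x * x - x = (Complex.exp (-(w / x)) - 1) * x := by
    rw [expNegDiv_of_ne _ hx']; ring
  rwa [h2, norm_mul, Complex.norm_of_nonneg hx.le]

lemma norm_expNegDiv_mul_sub_add_mul_le {w : ℂ} (hw : 0 ≤ w.re) {x : ℝ} (hx : 0 ≤ x) :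
    ‖(expNegDiv w x * x - x + w) * x‖ ≤ ‖w‖ ^ 2 := by
  rcases hx.eq_or_lt with rfl | hx
  · simp
  have hx' : (x : ℂ) ≠ 0 := by exact_mod_cast hx.ne'
  have h1 := Complex.norm_exp_neg_sub_one_add_le (u := w / x)
    (by rw [Complex.div_ofReal_re]; positivity)
  rw [norm_div, Complex.norm_of_nonneg hx.le, div_pow, le_div_iff₀ (by positivity)] at h1
  have h2 : (expNegDiv w x * x - x + w) * x = (Complex.exp (-(w / x)) - 1 + w / x) * x ^ 2 := by
    rw [expNegDiv_of_ne _ hx']; field_simp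
  rwa [h2, norm_mul, norm_pow, Complex.norm_of_nonneg hx.le]

/-- Since `z⁻¹ = 0` at `z = 0`, the function `z⁻¹ * expNegDiv w z` also vanishes at `0`. -/
lemma norm_inv_mul_expNegDiv_le_mul {w : ℂ} (hw : 0 < w.re) {x : ℝ} (hx : 0 < x) :
    ‖-((x : ℂ)⁻¹ * expNegDiv w x)‖ ≤ 2 / w.re ^ 2 * x := by
  rw [norm_neg, norm_mul, norm_inv, Complex.norm_of_nonneg hx.le, norm_expNegDiv_ofReal w hx]
  have := Real.sq_mul_exp_neg_le hw (inv_nonneg.2 hx.le)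
  have h2 := mul_le_mul_of_nonneg_right this hx.le
  refine le_trans (le_of_eq ?_) h2
  field_simp

/-- Second order Taylor estimate of `w ↦ exp (-w / x)`, uniform in `x ≥ 0`. -/
lemma norm_expNegDiv_taylor_le {w h : ℂ} (hw : 0 < w.re) (hh : ‖h‖ ≤ w.re / 2) {x : ℝ}
    (hx : 0 ≤ x) :
    ‖expNegDiv (w + h) x - expNegDiv w x - h * -((x : ℂ)⁻¹ * expNegDiv w x)‖
      ≤ 2 / (w.re / 2) ^ 2 * ‖h‖ ^ 2 := by
  rcases hx.eq_or_lt with rfl | hx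
  · simp only [Complex.ofReal_zero, expNegDiv_zero_right]
    simp only [sub_zero, mul_zero, neg_zero, norm_zero]
    positivity
  have hx' : (x : ℂ) ≠ 0 := by exact_mod_cast hx.ne'
  have hfac : expNegDiv (w + h) x - expNegDiv w x - h * -((x : ℂ)⁻¹ * expNegDiv w x)
      = expNegDiv w x * (Complex.exp (-(h / x)) - (1 + -(h / x))) := by
    rw [← expNegDiv_mul w h, expNegDiv_of_ne h hx']
    field_simp
    ring
  have h1 := Complex.norm_exp_sub_sum_le_norm_mul_exp (-(h / x)) 2
  simp only [Finset.sum_range_succ, Finset.sum_range_zero, pow_zero, Nat.factorial, Nat.cast_one,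
    div_one, pow_one, zero_add, Nat.succ_eq_add_one, mul_one] at h1
  rw [norm_neg, norm_div, Complex.norm_of_nonneg hx.le, div_eq_mul_inv ‖h‖] at h1
  have hs : 0 < x⁻¹ := inv_pos.2 hx
  rw [hfac, norm_mul, norm_expNegDiv_ofReal w hx]
  calc Real.exp (-(w.re * x⁻¹)) * ‖Complex.exp (-(h / x)) - (1 + -(h / x))‖
      ≤ Real.exp (-(w.re * x⁻¹)) * ((‖h‖ * x⁻¹) ^ 2 * Real.exp (‖h‖ * x⁻¹)) := by gcongr
    _ = ‖h‖ ^ 2 * (x⁻¹ ^ 2 * Real.exp (-(w.re * x⁻¹) + ‖h‖ * x⁻¹)) := by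
        rw [Real.exp_add]; ring
    _ ≤ ‖h‖ ^ 2 * (x⁻¹ ^ 2 * Real.exp (-(w.re / 2 * x⁻¹))) := by
        -- As `‖h‖ ≤ Re w / 2`, half of the decay rate `Re w` is left.
        gcongr
        nlinarith
    _ ≤ ‖h‖ ^ 2 * (2 / (w.re / 2) ^ 2) := by
        gcongr
        exact Real.sq_mul_exp_neg_le (by positivity) hs.le
    _ = _ := mul_comm _ _

end ScalarEstimates

/-- A bounded family of operators that tends to `0` on a dense range tends to `0` strongly. -/
lemma tendsto_apply_zero_of_denseRange {ι K : Type*} [NormedAddCommGroup K] [NormedSpace ℂ K]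
    {l : Filter ι} {R : K →L[ℂ] K} {P : ι → K →L[ℂ] K} {C : ℝ}
    (hP : ∀ᶠ i in l, ‖P i‖ ≤ C) (hd : DenseRange R)
    (h : Tendsto (fun i => P i * R) l (𝓝 0)) (x : K) : Tendsto (fun i => P i x) l (𝓝 0) := by
  rw [Metric.tendsto_nhds]
  intro ε hε
  have hC : 0 < |C| + 1 := by positivity
  obtain ⟨y, hy⟩ := hd.exists_dist_lt x (show 0 < ε / 2 / (|C| + 1) by positivity)
  have hy0 : Tendsto (fun i => P i (R y)) l (𝓝 0) := by
    have := ((ContinuousLinearMap.apply ℂ K y).continuous.tendsto 0).comp h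
    rwa [map_zero] at this
  filter_upwards [hP, Metric.tendsto_nhds.1 hy0 (ε / 2) (by positivity)] with i hi hiy
  rw [dist_zero_right] at hiy ⊢
  rw [dist_eq_norm, lt_div_iff₀ hC] at hy
  have h1 : ‖P i (x - R y)‖ ≤ ‖x - R y‖ * (|C| + 1) := by
    refine ((P i).le_of_opNorm_le hi _).trans ?_
    rw [mul_comm]
    gcongr
    linarith [le_abs_self C]
  have h2 : P i x = P i (x - R y) + P i (R y) := by rw [← map_add, sub_add_cancel]
  rw [h2]
  linarith [norm_add_le (P i (x - R y)) (P i (R y))]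

section Heat

variable {K : Type*} [NormedAddCommGroup K] [InnerProductSpace ℂ K] [CompleteSpace K]
  {R : K →L[ℂ] K}

open scoped ComplexOrder in
lemma exists_nonneg_of_mem_spectrum (hR : 0 ≤ R) {z : ℂ} (hz : z ∈ spectrum ℂ R) :
    ∃ x : ℝ, 0 ≤ x ∧ z = x := by
  have h := spectrum_nonneg_of_nonneg hR hz
  rw [Complex.nonneg_iff] at h
  exact ⟨z.re, h.1, Complex.ext rfl (by simpa using h.2.symm)⟩

/-- A function that is `O(x)` as `x ↓ 0` and continuous off `0` is continuous on the spectrum of a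
nonnegative operator. -/
lemma continuousOn_spectrum_of_norm_le_mul (hR : 0 ≤ R) {f : ℂ → ℂ} {C : ℝ} (h0 : f 0 = 0)
    (hf : ∀ z, z ≠ 0 → ContinuousAt f z) (hC : ∀ x : ℝ, 0 < x → ‖f x‖ ≤ C * x) :
    ContinuousOn f (spectrum ℂ R) := by
  intro z _
  rcases eq_or_ne z 0 with rfl | hz
  · have hlim : Tendsto (fun y : ℂ => C * ‖y‖) (𝓝[spectrum ℂ R] 0) (𝓝 0) := by
      have : Continuous fun y : ℂ => C * ‖y‖ := by fun_prop
      simpa using (this.tendsto 0).mono_left nhdsWithin_le_nhds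
    rw [ContinuousWithinAt, h0]
    refine squeeze_zero_norm' ?_ hlim
    filter_upwards [self_mem_nhdsWithin] with y hy
    obtain ⟨x, hx, rfl⟩ := exists_nonneg_of_mem_spectrum hR hy
    rw [Complex.norm_of_nonneg hx]
    rcases hx.eq_or_lt with rfl | hx
    · simp [h0]
    · exact hC x hx
  · exact (hf z hz).continuousWithinAt

lemma continuousOn_expNegDiv (hR : 0 ≤ R) {w : ℂ} (hw : 0 < w.re) :
    ContinuousOn (expNegDiv w) (spectrum ℂ R) :=
  continuousOn_spectrum_of_norm_le_mul hR (expNegDiv_zero_right w)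
    (fun _ hz => continuousAt_expNegDiv w hz) fun _ hx => norm_expNegDiv_le_mul hw hx

lemma continuousOn_inv_mul_expNegDiv (hR : 0 ≤ R) {w : ℂ} (hw : 0 < w.re) :
    ContinuousOn (fun z => -(z⁻¹ * expNegDiv w z)) (spectrum ℂ R) :=
  continuousOn_spectrum_of_norm_le_mul hR (by simp)
    (fun _ hz => ((continuousAt_inv₀ hz).mul (continuousAt_expNegDiv w hz)).neg)
    fun _ hx => norm_inv_mul_expNegDiv_le_mul hw hx

lemma norm_cfc_le_of_nonneg (hR : 0 ≤ R) {f : ℂ → ℂ} {c : ℝ} (hc : 0 ≤ c)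
    (hf : ∀ x : ℝ, 0 ≤ x → ‖f x‖ ≤ c) : ‖cfc f R‖ ≤ c := by
  refine norm_cfc_le hc fun z hz => ?_
  obtain ⟨x, hx, rfl⟩ := exists_nonneg_of_mem_spectrum hR hz
  exact hf x hx

/-- The operator `exp (-w R⁻¹)` for an injective bounded operator `R ≥ 0` and `0 < Re w`, given by
the continuous functional calculus of `R`; at `w = 0` it is the identity. -/
def heat (R : K →L[ℂ] K) (w : ℂ) : K →L[ℂ] K := if w = 0 then 1 else cfc (expNegDiv w) R

@[simp]
lemma heat_zero : heat R 0 = 1 := if_pos rfl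

lemma heat_of_re_pos {w : ℂ} (hw : 0 < w.re) : heat R w = cfc (expNegDiv w) R :=
  if_neg fun h => by simp [h] at hw

lemma heat_add (hR : 0 ≤ R) {w₁ w₂ : ℂ} (h₁ : w₁ = 0 ∨ 0 < w₁.re) (h₂ : w₂ = 0 ∨ 0 < w₂.re) :
    heat R (w₁ + w₂) = heat R w₁ * heat R w₂ := by
  rcases h₁ with rfl | h₁
  · simp
  rcases h₂ with rfl | h₂
  · simp
  rw [heat_of_re_pos h₁, heat_of_re_pos h₂, heat_of_re_pos (by simpa using add_pos h₁ h₂),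
    ← cfc_mul _ _ R (continuousOn_expNegDiv hR h₁) (continuousOn_expNegDiv hR h₂)]
  exact cfc_congr fun z _ => (expNegDiv_mul w₁ w₂ z).symm

lemma norm_heat_le (hR : 0 ≤ R) {w : ℂ} (hw : 0 < w.re) : ‖heat R w‖ ≤ 1 := by
  rw [heat_of_re_pos hw]
  exact norm_cfc_le_of_nonneg hR zero_le_one fun x hx => norm_expNegDiv_le_one hw.le hx

lemma commute_heat (hR : 0 ≤ R) {M : K →L[ℂ] K} (hM : Commute R M) (w : ℂ) :
    Commute (heat R w) M := by
  rw [heat]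
  split_ifs
  · exact Commute.one_left M
  · exact (IsSelfAdjoint.of_nonneg hR).commute_cfc hM _

lemma heat_mul_sub_eq_cfc (hR : 0 ≤ R) {w : ℂ} (hw : 0 < w.re) :
    heat R w * R - R = cfc (fun z => expNegDiv w z * z - z) R := by
  have hc := continuousOn_expNegDiv hR hw
  have hn : IsStarNormal R := (IsSelfAdjoint.of_nonneg hR).isStarNormal
  rw [cfc_sub (fun z => expNegDiv w z * z) (fun z => z) R (hc.mul continuousOn_id)
      continuousOn_id,
    cfc_mul (expNegDiv w) (fun z => z) R hc continuousOn_id, heat_of_re_pos hw, cfc_id' ℂ R]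

lemma norm_heat_mul_sub_le (hR : 0 ≤ R) {w : ℂ} (hw : 0 < w.re) :
    ‖heat R w * R - R‖ ≤ ‖w‖ := by
  rw [heat_mul_sub_eq_cfc hR hw]
  exact norm_cfc_le_of_nonneg hR (norm_nonneg w) fun x hx => norm_expNegDiv_mul_sub_le hw.le hx

lemma norm_heat_mul_sub_add_mul_le (hR : 0 ≤ R) {w : ℂ} (hw : 0 < w.re) :
    ‖(heat R w * R - R + w • 1) * R‖ ≤ ‖w‖ ^ 2 := by
  have hc := continuousOn_expNegDiv hR hw
  have hn : IsStarNormal R := (IsSelfAdjoint.of_nonneg hR).isStarNormal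
  have hc' : ContinuousOn (fun z => expNegDiv w z * z - z) (spectrum ℂ R) :=
    (hc.mul continuousOn_id).sub continuousOn_id
  have h1 : (heat R w * R - R + w • 1) * R
      = cfc (fun z => (expNegDiv w z * z - z + w) * z) R := by
    rw [cfc_mul (fun z => expNegDiv w z * z - z + w) (fun z => z) R
        (hc'.add continuousOn_const) continuousOn_id,
      cfc_add (a := R) (fun z => expNegDiv w z * z - z) (fun _ => w) hc' continuousOn_const,
      cfc_const w R, cfc_id' ℂ R, heat_mul_sub_eq_cfc hR hw,
      Algebra.algebraMap_eq_smul_one]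
  rw [h1]
  exact norm_cfc_le_of_nonneg hR (by positivity) fun x hx =>
    norm_expNegDiv_mul_sub_add_mul_le hw.le hx

lemma hasDerivAt_heat (hR : 0 ≤ R) {w : ℂ} (hw : 0 < w.re) :
    HasDerivAt (heat R) (cfc (fun z => -(z⁻¹ * expNegDiv w z)) R) w := by
  rw [hasDerivAt_iff_isLittleO_nhds_zero]
  refine (Asymptotics.IsBigO.of_bound (2 / (w.re / 2) ^ 2) ?_).trans_isLittleO
    (Asymptotics.isLittleO_pow_id (𝕜 := ℂ) one_lt_two)
  filter_upwards [Metric.ball_mem_nhds (0 : ℂ) (half_pos hw)] with h hh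
  rw [mem_ball_zero_iff] at hh
  have hre : 0 < (w + h).re := by
    have := (abs_le.1 (Complex.abs_re_le_norm h)).1
    rw [Complex.add_re]
    linarith
  have hc := continuousOn_expNegDiv hR hw
  have hch := continuousOn_expNegDiv hR hre
  have hd := continuousOn_inv_mul_expNegDiv hR hw
  have h1 : heat R (w + h) - heat R w - h • cfc (fun z => -(z⁻¹ * expNegDiv w z)) R
      = cfc (fun z => expNegDiv (w + h) z - expNegDiv w z - h * -(z⁻¹ * expNegDiv w z)) R := by
    rw [cfc_sub (fun z => expNegDiv (w + h) z - expNegDiv w z)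
        (fun z => h * -(z⁻¹ * expNegDiv w z)) R (hch.sub hc) (continuousOn_const.mul hd),
      cfc_sub (expNegDiv (w + h)) (expNegDiv w) R hch hc, cfc_const_mul h _ R hd,
      heat_of_re_pos hw, heat_of_re_pos hre]
  rw [h1, norm_pow]
  exact norm_cfc_le_of_nonneg hR (by positivity) fun x hx =>
    norm_expNegDiv_taylor_le hw hh.le hx

lemma tendsto_norm_halfPlane : Tendsto (fun w : ℂ => ‖w‖) (𝓝[{w : ℂ | 0 < w.re}] 0) (𝓝 0) := by
  simpa using ((continuous_norm (E := ℂ)).tendsto 0).mono_left nhdsWithin_le_nhds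

lemma tendsto_heat_apply (hR : 0 ≤ R) (hd : DenseRange R) (x : K) :
    Tendsto (fun w => heat R w x) (𝓝[{w : ℂ | 0 < w.re}] 0) (𝓝 x) := by
  have h := tendsto_apply_zero_of_denseRange (R := R) (l := 𝓝[{w : ℂ | 0 < w.re}] 0)
    (P := fun w => heat R w - 1) (C := 1 + 1)
    (by
      filter_upwards [self_mem_nhdsWithin] with w hw
      exact (norm_sub_le _ _).trans
        (add_le_add (norm_heat_le hR hw) ContinuousLinearMap.norm_id_le)) hd
    (by
      refine squeeze_zero_norm' ?_ tendsto_norm_halfPlane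
      filter_upwards [self_mem_nhdsWithin] with w hw
      rw [sub_mul, one_mul]
      exact norm_heat_mul_sub_le hR hw) x
  simpa using h.add_const x

/-- The generator of `exp (-w R⁻¹)` is `-R⁻¹`, also for complex `w → 0` with `0 < Re w`. The
operators `w⁻¹ (exp (-w R⁻¹) R - R + w)` are bounded uniformly in `w`, and they are `O(w)` after composition
with `R`. -/
lemma tendsto_heat_slope (hR : 0 ≤ R) (hd : DenseRange R) (x : K) :
    Tendsto (fun w => w⁻¹ • (heat R w (R x) - R x)) (𝓝[{w : ℂ | 0 < w.re}] 0) (𝓝 (-x)) := by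
  have hne {w : ℂ} (hw : 0 < w.re) : w ≠ 0 := fun h => by simp [h] at hw
  have h := tendsto_apply_zero_of_denseRange (R := R) (l := 𝓝[{w : ℂ | 0 < w.re}] 0)
    (P := fun w => w⁻¹ • (heat R w * R - R + w • 1)) (C := 2)
    (by
      filter_upwards [self_mem_nhdsWithin] with w hw
      have hw0 : 0 < ‖w‖ := norm_pos_iff.2 (hne hw)
      have h1 : ‖w • (1 : K →L[ℂ] K)‖ ≤ ‖w‖ := by
        rw [norm_smul]
        exact mul_le_of_le_one_right (norm_nonneg _) ContinuousLinearMap.norm_id_le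
      rw [norm_smul, norm_inv, inv_mul_le_iff₀ hw0]
      linarith [norm_add_le (heat R w * R - R) (w • 1), norm_heat_mul_sub_le hR hw]) hd
    (by
      refine squeeze_zero_norm' ?_ tendsto_norm_halfPlane
      filter_upwards [self_mem_nhdsWithin] with w hw
      have hw0 : 0 < ‖w‖ := norm_pos_iff.2 (hne hw)
      rw [smul_mul_assoc, norm_smul, norm_inv, inv_mul_le_iff₀ hw0, ← sq]
      exact norm_heat_mul_sub_add_mul_le hR hw) x
  have h2 := h.sub_const x
  rw [zero_sub] at h2
  refine h2.congr' ?_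
  filter_upwards [self_mem_nhdsWithin] with w hw
  simp [smul_add, smul_smul, inv_mul_cancel₀ (hne hw)]

end Heat

/-! ### Semigroups generated by a product with a diagonalizable operator -/

section EigenDecomposition

/-- A resolution of the identity that diagonalizes the element `M` of a complex algebra: disjoint
projections `Eᵢ` with sum `1` and `M Eᵢ = μᵢ Eᵢ`, each of which commutes with everything that
commutes with `M`. -/
structure EigenDecomposition {𝔸 : Type*} [Ring 𝔸] [Algebra ℂ 𝔸] (M : 𝔸) (ι : Type*)
    [Fintype ι] where
  /-- The eigenvalues `μᵢ`. -/
  eigenvalue : ι → ℂ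
  /-- The spectral projections `Eᵢ`. -/
  proj : ι → 𝔸
  sum_proj : ∑ i, proj i = 1
  proj_mul_proj : ∀ i j, i ≠ j → proj i * proj j = 0
  mul_proj : ∀ i, M * proj i = eigenvalue i • proj i
  commute_proj : ∀ i b, Commute b M → Commute b (proj i)

variable {𝔸 ι : Type*} [Ring 𝔸] [Algebra ℂ 𝔸] [Fintype ι] {M : 𝔸}

open Polynomial in
/-- An element that is annihilated by a polynomial with simple roots is diagonalized by the
Lagrange basis polynomials at these roots. -/
def EigenDecomposition.ofNodal [DecidableEq ι] [Nonempty ι] (μ : ι → ℂ)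
    (hμ : Function.Injective μ) (hM : aeval M (Lagrange.nodal Finset.univ μ) = 0) :
    EigenDecomposition M ι where
  eigenvalue := μ
  proj i := aeval M (Lagrange.basis Finset.univ μ i)
  sum_proj := by
    rw [← map_sum (aeval M), Lagrange.sum_basis hμ.injOn Finset.univ_nonempty, map_one]
  proj_mul_proj i j hij := by
    have hdvd : Lagrange.nodal Finset.univ μ ∣
        Lagrange.basis Finset.univ μ i * Lagrange.basis Finset.univ μ j := by
      rw [Lagrange.basis_eq_prod_sub_inv_mul_nodal_div (Finset.mem_univ i),
        ← Lagrange.nodal_erase_eq_nodal_div (Finset.mem_univ i),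
        Lagrange.nodal_eq_mul_nodal_erase (Finset.mem_univ i), mul_comm (X - _)]
      refine mul_dvd_mul (Dvd.intro_left _ rfl) ?_
      rw [Polynomial.dvd_iff_isRoot]
      exact Lagrange.eval_basis_of_ne hij.symm (Finset.mem_univ i)
    obtain ⟨q, hq⟩ := hdvd
    rw [← map_mul, hq, map_mul, hM, zero_mul]
  mul_proj i := by
    have h : (X - C (μ i)) * Lagrange.basis Finset.univ μ i
        = C (Lagrange.nodalWeight Finset.univ μ i) * Lagrange.nodal Finset.univ μ := by
      rw [Lagrange.basis_eq_prod_sub_inv_mul_nodal_div (Finset.mem_univ i),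
        ← Lagrange.nodal_erase_eq_nodal_div (Finset.mem_univ i),
        Lagrange.nodal_eq_mul_nodal_erase (Finset.mem_univ i)]
      ring
    have h2 := congrArg (aeval M) h
    rw [map_mul, map_mul, hM, mul_zero, map_sub, aeval_X, aeval_C, sub_mul, sub_eq_zero] at h2
    rw [h2, Algebra.smul_def]
  commute_proj i b hb := Algebra.commute_of_mem_adjoin_singleton_of_commute
    (aeval_mem_adjoin_singleton ℂ M) hb

namespace EigenDecomposition

variable (D : EigenDecomposition M ι)

lemma proj_mul_self (i : ι) : D.proj i * D.proj i = D.proj i := by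
  classical
  conv_rhs => rw [← mul_one (D.proj i), ← D.sum_proj, Finset.mul_sum]
  rw [Finset.sum_eq_single_of_mem i (Finset.mem_univ i) fun j _ hj =>
    D.proj_mul_proj i j hj.symm]

lemma sum_smul_proj : ∑ i, D.eigenvalue i • D.proj i = M := by
  simp_rw [← D.mul_proj, ← Finset.mul_sum, D.sum_proj, mul_one]

/-- If no eigenvalue vanishes, then `M` is invertible, with inverse `∑ μᵢ⁻¹ Eᵢ`. -/
lemma isUnit (hD : ∀ i, D.eigenvalue i ≠ 0) : IsUnit M := by
  have h : M * ∑ i, (D.eigenvalue i)⁻¹ • D.proj i = 1 := by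
    simp_rw [Finset.mul_sum, mul_smul_comm, D.mul_proj, smul_smul,
      inv_mul_cancel₀ (hD _), one_smul, D.sum_proj]
  have hcomm : Commute M (∑ i, (D.eigenvalue i)⁻¹ • D.proj i) :=
    Commute.sum_right _ _ _ fun i _ => (D.commute_proj i M (Commute.refl M)).smul_right _
  exact ⟨⟨M, _, h, hcomm.eq ▸ h⟩, rfl⟩

lemma eigenvalue_ne_zero (hD : ∀ i, (D.eigenvalue i).re < 0) (i : ι) : D.eigenvalue i ≠ 0 :=
  fun h => by simpa [h] using hD i

/-- The set of the `z` for which all the factors `exp (z μᵢ R⁻¹)` decay. -/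
def decayRegion (D : EigenDecomposition M ι) : Set ℂ :=
  {z | ∀ i, 0 < (-(D.eigenvalue i * z)).re}

lemma tendsto_neg_eigenvalue_mul (i : ι) :
    Tendsto (fun z : ℂ => -(D.eigenvalue i * z)) (𝓝[D.decayRegion] 0) (𝓝[{w | 0 < w.re}] 0) := by
  refine tendsto_nhdsWithin_iff.2 ⟨?_, ?_⟩
  · have : Continuous fun z : ℂ => -(D.eigenvalue i * z) := by fun_prop
    simpa using (this.tendsto 0).mono_left nhdsWithin_le_nhds
  · filter_upwards [self_mem_nhdsWithin] with z hz using hz i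

lemma ofReal_mem_decayRegion (hD : ∀ i, (D.eigenvalue i).re < 0) {t : ℝ} (ht : 0 < t) :
    (t : ℂ) ∈ D.decayRegion := by
  intro i
  rw [Complex.neg_re, Complex.re_mul_ofReal]
  nlinarith [hD i]

/-- If all eigenvalues have negative real part, then the factors `exp (z μᵢ R⁻¹)` decay in a sector
around the positive half-line. -/
lemma exists_sector_subset_decayRegion (hD : ∀ i, (D.eigenvalue i).re < 0) :
    ∃ φ : ℝ, 0 < φ ∧ φ ≤ Real.pi / 2 ∧ C0Semigroup.sector φ ⊆ D.decayRegion := by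
  have hev : ∀ᶠ θ in 𝓝 (0 : ℝ), ∀ i,
      0 < (D.eigenvalue i).im * Real.sin θ - (D.eigenvalue i).re * Real.cos θ := by
    refine eventually_all.2 fun i => ?_
    have hc : Continuous fun θ => (D.eigenvalue i).im * Real.sin θ
      - (D.eigenvalue i).re * Real.cos θ := by fun_prop
    exact (hc.tendsto 0).eventually_const_lt (by simpa using hD i)
  obtain ⟨ε, hε, h⟩ := Metric.eventually_nhds_iff.1 hev
  refine ⟨min ε (Real.pi / 2), lt_min hε (by positivity), min_le_right _ _, fun z hz i => ?_⟩
  have h1 := h (y := z.arg) (by simpa using hz.2.trans_le (min_le_left _ _)) i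
  have h2 : (-(D.eigenvalue i * z)).re = ‖z‖ *
      ((D.eigenvalue i).im * Real.sin z.arg - (D.eigenvalue i).re * Real.cos z.arg) := by
    have hre := Complex.norm_mul_cos_arg z
    have him := Complex.norm_mul_sin_arg z
    rw [Complex.neg_re, Complex.mul_re, ← hre, ← him]
    simp only [Complex.norm_mul_cos_arg, Complex.norm_mul_sin_arg]
    rw [mul_sub, mul_left_comm, him, mul_left_comm, hre]
    ring
  rw [h2]
  exact mul_pos (norm_pos_iff.2 hz.1) h1

lemma tendsto_ofReal_decayRegion (hD : ∀ i, (D.eigenvalue i).re < 0) :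
    Tendsto (fun t : ℝ≥0 => ((t : ℝ) : ℂ)) (𝓝[>] 0) (𝓝[D.decayRegion] 0) := by
  refine tendsto_nhdsWithin_iff.2 ⟨?_, ?_⟩
  · have : Continuous fun t : ℝ≥0 => ((t : ℝ) : ℂ) := by fun_prop
    simpa using (this.tendsto 0).mono_left nhdsWithin_le_nhds
  · filter_upwards [self_mem_nhdsWithin] with t ht
    exact D.ofReal_mem_decayRegion hD ht

lemma ofReal_eq_zero_or_mem_decayRegion (hD : ∀ i, (D.eigenvalue i).re < 0) (t : ℝ≥0) :
    ((t : ℝ) : ℂ) = 0 ∨ ((t : ℝ) : ℂ) ∈ D.decayRegion := by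
  rcases eq_zero_or_pos t with rfl | ht
  · simp
  · exact Or.inr (D.ofReal_mem_decayRegion hD ht)

/-- The solutions of `M x = R y` are the pairs `(R q, M q)`. -/
lemma exists_eq_of_apply_eq {K : Type*} [NormedAddCommGroup K] [NormedSpace ℂ K]
    {R M : K →L[ℂ] K} (D : EigenDecomposition M ι) (hRM : Commute R M)
    (hD : ∀ i, (D.eigenvalue i).re < 0) {x y : K} (h : M x = R y) : ∃ q, x = R q ∧ y = M q := by
  obtain ⟨U, hU⟩ := D.isUnit (D.eigenvalue_ne_zero hD)
  have hMU (z : K) : M (U⁻¹.val z) = z := by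
    rw [← hU]
    exact DFunLike.congr_fun U.mul_inv z
  have hUM (z : K) : U⁻¹.val (M z) = z := by
    rw [← hU]
    exact DFunLike.congr_fun U.inv_mul z
  have hRMz (z : K) : R (M z) = M (R z) := DFunLike.congr_fun hRM.eq z
  refine ⟨U⁻¹.val y, ?_, (hMU y).symm⟩
  rw [← hUM x, h, ← hUM (R (U⁻¹.val y)), ← hRMz, hMU]

end EigenDecomposition

end EigenDecomposition

section Evolution

variable {K ι : Type*} [NormedAddCommGroup K] [InnerProductSpace ℂ K] [CompleteSpace K]
  [Fintype ι] {R M : K →L[ℂ] K}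

namespace EigenDecomposition

/-- The evolution operator `exp (z R⁻¹ M) = ∑ exp (z μᵢ R⁻¹) Eᵢ`. -/
def evolution (D : EigenDecomposition M ι) (R : K →L[ℂ] K) (z : ℂ) : K →L[ℂ] K :=
  ∑ i, D.proj i * heat R (-(D.eigenvalue i * z))

variable (D : EigenDecomposition M ι)

lemma evolution_apply (z : ℂ) (x : K) :
    D.evolution R z x = ∑ i, D.proj i (heat R (-(D.eigenvalue i * z)) x) := by
  simp [evolution]

lemma evolution_zero : D.evolution R 0 = 1 := by
  simp [evolution, D.sum_proj]

lemma evolution_add (hR : 0 ≤ R) (hRM : Commute R M) {z w : ℂ} (hz : z = 0 ∨ z ∈ D.decayRegion)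
    (hw : w = 0 ∨ w ∈ D.decayRegion) :
    D.evolution R (z + w) = D.evolution R z * D.evolution R w := by
  classical
  have hcases {z : ℂ} (hz : z = 0 ∨ z ∈ D.decayRegion) (i : ι) :
      -(D.eigenvalue i * z) = 0 ∨ 0 < (-(D.eigenvalue i * z)).re :=
    hz.imp (fun h => by simp [h]) fun h => h i
  have hcomm (i : ι) (w : ℂ) : heat R w * D.proj i = D.proj i * heat R w :=
    (commute_heat hR (D.commute_proj i R hRM) w).eq
  simp_rw [evolution, Finset.sum_mul_sum]
  refine Finset.sum_congr rfl fun i _ => ?_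
  rw [Finset.sum_eq_single_of_mem i (Finset.mem_univ i) fun j _ hj => ?_]
  · rw [mul_add, neg_add, heat_add hR (hcases hz i) (hcases hw i), mul_assoc,
      ← mul_assoc (heat R _),
      hcomm, ← mul_assoc (D.proj i), ← mul_assoc (D.proj i), ← mul_assoc (D.proj i),
      D.proj_mul_self]
  · rw [mul_assoc, ← mul_assoc (heat R _), hcomm, mul_assoc, ← mul_assoc (D.proj i),
      D.proj_mul_proj i j hj.symm, zero_mul]

lemma differentiableOn_evolution (hR : 0 ≤ R) :
    DifferentiableOn ℂ (D.evolution R) D.decayRegion := by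
  intro z hz
  refine DifferentiableAt.differentiableWithinAt ?_
  unfold evolution
  refine DifferentiableAt.fun_sum fun i _ => DifferentiableAt.const_mul ?_ _
  have hg : DifferentiableAt ℂ (fun z => -(D.eigenvalue i * z)) z := by fun_prop
  exact (hasDerivAt_heat hR (hz i)).differentiableAt.comp z hg

lemma tendsto_evolution_apply (hR : 0 ≤ R) (hd : DenseRange R) (x : K) :
    Tendsto (fun z => D.evolution R z x) (𝓝[D.decayRegion] 0) (𝓝 x) := by
  have hx : ∑ i, D.proj i x = x := by
    rw [← sum_apply, D.sum_proj, one_apply_eq_self]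
  simp_rw [evolution_apply]
  nth_rw 2 [← hx]
  exact tendsto_finsetSum _ fun i _ => ((D.proj i).continuous.tendsto x).comp
    ((tendsto_heat_apply hR hd x).comp (D.tendsto_neg_eigenvalue_mul i))

/-- On the range of `R` the generator of `exp (z R⁻¹ M)` acts as `R x ↦ M x`. -/
lemma tendsto_evolution_slope (hR : 0 ≤ R) (hd : DenseRange R)
    (hD : ∀ i, D.eigenvalue i ≠ 0) (x : K) :
    Tendsto (fun z => z⁻¹ • (D.evolution R z (R x) - R x)) (𝓝[D.decayRegion] 0) (𝓝 (M x)) := by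
  have hproj (y : K) : ∑ i, D.proj i y = y := by
    rw [← sum_apply, D.sum_proj, one_apply_eq_self]
  have hM : ∑ i, D.proj i (-D.eigenvalue i • -x) = M x := by
    conv_rhs => rw [← D.sum_smul_proj, sum_apply]
    simp
  rw [← hM]
  have hlim := tendsto_finsetSum (Finset.univ : Finset ι) fun i _ =>
    ((D.proj i).continuous.tendsto _).comp
      (((tendsto_heat_slope hR hd x).comp (D.tendsto_neg_eigenvalue_mul i)).const_smul
        (-D.eigenvalue i))
  refine hlim.congr fun z => ?_
  conv_rhs => rw [← hproj (R x), evolution_apply, ← Finset.sum_sub_distrib, Finset.smul_sum]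
  refine Finset.sum_congr rfl fun i _ => ?_
  have h1 : -D.eigenvalue i * (-(D.eigenvalue i * z))⁻¹ = z⁻¹ := by
    rw [← neg_mul, mul_inv, mul_inv_cancel_left₀ (neg_ne_zero.2 (hD i))]
  simp only [Function.comp_apply]
  rw [smul_smul, h1, map_smul, map_sub, hproj]

/-- The `C₀`-semigroup `t ↦ exp (t R⁻¹ M)`. -/
def semigroup (hR : 0 ≤ R) (hd : DenseRange R) (hRM : Commute R M)
    (hD : ∀ i, (D.eigenvalue i).re < 0) : C0Semigroup K where
  op t := D.evolution R (t : ℝ)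
  op_zero := D.evolution_zero
  op_add s t := by
    have := D.evolution_add hR hRM (D.ofReal_eq_zero_or_mem_decayRegion hD s)
      (D.ofReal_eq_zero_or_mem_decayRegion hD t)
    rw [NNReal.coe_add, Complex.ofReal_add, this]
    rfl
  tendsto_zero x := (D.tendsto_evolution_apply hR hd x).comp (D.tendsto_ofReal_decayRegion hD)

variable (hR : 0 ≤ R) (hd : DenseRange R) (hRM : Commute R M)
  (hD : ∀ i, (D.eigenvalue i).re < 0)
include hD

lemma isAnalytic_semigroup : (D.semigroup hR hd hRM hD).IsAnalytic := by
  obtain ⟨φ, hφ, hφ', hsub⟩ := D.exists_sector_subset_decayRegion hD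
  exact ⟨φ, hφ, hφ', D.evolution R, fun _ => rfl, (D.differentiableOn_evolution hR).mono hsub,
    fun z hz w hw => D.evolution_add hR hRM (Or.inr (hsub hz)) (Or.inr (hsub hw)),
    fun x => (D.tendsto_evolution_apply hR hd x).mono_left (nhdsWithin_mono _ hsub)⟩

lemma hasGenerator_semigroup {B : K →ₗ.[ℂ] K}
    (hB : ∀ x y, (x, y) ∈ B.graph ↔ M x = R y) :
    (D.semigroup hR hd hRM hD).HasGenerator B := by
  have hlim (q : K) : Tendsto (fun t : ℝ≥0 => ((t : ℝ) : ℂ)⁻¹ •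
      ((D.semigroup hR hd hRM hD).op t (R q) - R q)) (𝓝[>] 0) (𝓝 (M q)) :=
    (D.tendsto_evolution_slope hR hd (D.eigenvalue_ne_zero hD) q).comp
      (D.tendsto_ofReal_decayRegion hD)
  intro x y
  rw [hB]
  constructor
  · intro h
    obtain ⟨q, rfl, rfl⟩ := D.exists_eq_of_apply_eq hRM hD h
    exact hlim q
  · intro h
    -- Apply `R` to the difference quotients of `x`: these are the difference quotients of `R x`.
    refine tendsto_nhds_unique (hlim x) (((R.continuous.tendsto y).comp h).congr fun t => ?_)
    have hcomm : R ((D.semigroup hR hd hRM hD).op t x) = (D.semigroup hR hd hRM hD).op t (R x) := by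
      have : Commute R (D.evolution R (t : ℝ)) := Commute.sum_right _ _ _ fun i _ =>
        (D.commute_proj i R hRM).mul_right (commute_heat hR (Commute.refl R) _).symm
      exact DFunLike.congr_fun this.eq x
    simp only [Function.comp_apply, map_smul, map_sub, hcomm]

include hR hd hRM in
/-- The operator `B = R⁻¹ M`, when it is dissipative, generates a unique `C₀`-semigroup, and this
semigroup is contractive and analytic. -/
theorem exists_semigroup {B : K →ₗ.[ℂ] K}
    (hB : ∀ x y, (x, y) ∈ B.graph ↔ M x = R y) (hdiss : ∀ q, (inner ℂ (M q) (R q)).re ≤ 0) :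
    ∃ S : C0Semigroup K, S.HasGenerator B ∧ S.IsContraction ∧
      (∀ T : C0Semigroup K, T.HasGenerator B → T = S) ∧ S.IsAnalytic := by
  have hdense : Dense (B.domain : Set K) := by
    refine hd.mono ?_
    rintro _ ⟨q, rfl⟩
    exact LinearPMap.mem_domain_of_mem_graph
      ((hB _ _).2 (DFunLike.congr_fun hRM.eq q : R (M q) = M (R q)).symm)
  have hdiss' (x y : K) (hxy : (x, y) ∈ B.graph) : (inner ℂ y x).re ≤ 0 := by
    obtain ⟨q, rfl, rfl⟩ := D.exists_eq_of_apply_eq hRM hD ((hB x y).1 hxy)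
    exact hdiss q
  have hS := D.hasGenerator_semigroup hR hd hRM hD hB
  exact ⟨D.semigroup hR hd hRM hD, hS, hS.isContraction hdense hdiss',
    fun T hT => hS.unique hT hdense hdiss', D.isAnalytic_semigroup hR hd hRM hD⟩

end EigenDecomposition

end Evolution

/-! ### The thermoelastic plate -/

section CharacteristicPolynomial

lemma re_neg_of_plate_cubic_eq_zero {z : ℂ} (hz : z ^ 3 + z ^ 2 + 2 * z + 1 = 0) : z.re < 0 := by
  obtain ⟨x, y⟩ := z
  have hre := congrArg Complex.re hz
  have him := congrArg Complex.im hz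
  simp only [pow_succ, pow_zero, one_mul, Complex.add_re, Complex.add_im, Complex.mul_re,
    Complex.mul_im, Complex.re_ofNat, Complex.im_ofNat, Complex.one_re, Complex.one_im,
    Complex.zero_re, Complex.zero_im] at hre him
  by_contra! hx
  change 0 ≤ x at hx
  have hfac : y * (3 * x ^ 2 + 2 * x + 2 - y ^ 2) = 0 := by linarith
  rcases mul_eq_zero.1 hfac with rfl | hy
  · nlinarith [pow_nonneg hx 3, pow_nonneg hx 2]
  · have hy' : y ^ 2 = 3 * x ^ 2 + 2 * x + 2 := by linarith
    have : x ^ 3 + x ^ 2 + 2 * x + 1 - (3 * x + 1) * y ^ 2 = 0 := by linarith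
    rw [hy'] at this
    nlinarith [pow_nonneg hx 3, pow_nonneg hx 2]

open Polynomial in
/-- The characteristic polynomial of the matrix `!![0, 1, 0; -1, 0, 1; 0, -1, -1]` of the plate
system has three distinct roots, all in the open left half-plane. -/
lemma exists_plate_eigenvalues : ∃ μ : Fin 3 → ℂ, Function.Injective μ ∧ (∀ i, (μ i).re < 0) ∧
    Lagrange.nodal Finset.univ μ = X ^ 3 + X ^ 2 + 2 * X + 1 := by
  obtain ⟨a, ha⟩ : ∃ a : ℂ, a ^ 3 + a ^ 2 + 2 * a + 1 = 0 := by
    have hc : ContinuousOn (fun x : ℝ => x ^ 3 + x ^ 2 + 2 * x + 1) (Set.Icc (-1) 0) := by fun_prop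
    obtain ⟨x, -, hx⟩ := intermediate_value_Icc (by norm_num) hc
      (show (0 : ℝ) ∈ _ by constructor <;> norm_num)
    exact ⟨x, by exact_mod_cast hx⟩
  -- The other two roots are those of `X² + (1 + a) X + (2 + a + a²)`.
  obtain ⟨s, hs⟩ := IsAlgClosed.exists_pow_nat_eq ((1 + a) ^ 2 - 4 * (2 + a + a ^ 2)) two_pos
  obtain ⟨b, hb⟩ : ∃ b : ℂ, b = (-(1 + a) + s) / 2 := ⟨_, rfl⟩
  obtain ⟨c, hc⟩ : ∃ c : ℂ, c = (-(1 + a) - s) / 2 := ⟨_, rfl⟩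
  have e1 : a + b + c = -1 := by rw [hb, hc]; ring
  have e2 : a * b + b * c + c * a = 2 := by
    rw [hb, hc]
    linear_combination -(1 / 4 : ℂ) * hs
  have e3 : a * b * c = -1 := by
    rw [hb, hc]
    linear_combination -(a / 4 : ℂ) * hs + ha
  have hprod : (X - C a) * (X - C b) * (X - C c) = (X ^ 3 + X ^ 2 + 2 * X + 1 : ℂ[X]) := by
    have f1 := congrArg (C : ℂ → ℂ[X]) e1
    have f2 := congrArg (C : ℂ → ℂ[X]) e2
    have f3 := congrArg (C : ℂ → ℂ[X]) e3
    simp only [C_add, C_mul, C_neg, C_1, C_ofNat] at f1 f2 f3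
    linear_combination -X ^ 2 * f1 + X * f2 - f3
  have hroot (z : ℂ) : z ^ 3 + z ^ 2 + 2 * z + 1 = (z - a) * (z - b) * (z - c) := by
    simpa using (congrArg (eval z) hprod).symm
  -- A double root `z` would also be a root of the derivative `3 z² + 2 z + 2`.
  have hsimple (z : ℂ) (hz : z ^ 3 + z ^ 2 + 2 * z + 1 = 0) : 3 * z ^ 2 + 2 * z + 2 ≠ 0 := by
    intro hz'
    -- Euclid's algorithm for the cubic and its derivative ends with a nonzero constant.
    have : (207 : ℂ) = 0 := by
      linear_combination 100 * hz' - (30 * z - 1) * (9 * hz - (3 * z + 1) * hz')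
    norm_num at this
  have hb : b ^ 3 + b ^ 2 + 2 * b + 1 = 0 := (hroot b).trans (by ring)
  have hab : a ≠ b := by
    rintro rfl
    exact hsimple a ha (by linear_combination 2 * a * e1 - e2)
  have hac : a ≠ c := by
    rintro rfl
    exact hsimple a ha (by linear_combination 2 * a * e1 - e2)
  have hbc : b ≠ c := by
    rintro rfl
    exact hsimple b hb (by linear_combination 2 * b * e1 - e2)
  refine ⟨![a, b, c], ?_, ?_, ?_⟩
  · intro i j
    fin_cases i <;> fin_cases j <;> simp [hab, hac, hbc, hab.symm, hac.symm, hbc.symm]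
  · intro i
    apply re_neg_of_plate_cubic_eq_zero
    rw [hroot]
    fin_cases i <;> simp
  · rw [Lagrange.nodal_eq, Fin.prod_univ_three, ← hprod]
    rfl

end CharacteristicPolynomial

namespace PosDefOperator

variable {H : Type*} [NormedAddCommGroup H] [InnerProductSpace ℂ H] [CompleteSpace H]
  (A : PosDefOperator H)

lemma inv_map (u : A.H2) : A.inv (A.map u) = u :=
  A.map_injective (A.map_inv (A.map u))

lemma inner_map_incl (u v : A.H2) :
    inner ℂ (A.map u) (A.incl v) = inner ℂ (A.incl u) (A.map v) := by
  have hstar : A.toPMap.adjoint = A.toPMap := A.selfAdjoint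
  have h := LinearPMap.adjoint_isFormalAdjoint A.selfAdjoint.dense_domain
  rw [hstar] at h
  exact h u v

lemma re_inner_map_incl_nonneg (u : A.H2) : 0 ≤ (inner ℂ (A.map u) (A.incl u)).re := by
  obtain ⟨c, hc, h⟩ := A.posDef
  exact (by positivity : (0 : ℝ) ≤ c * ‖(A.incl u : H)‖ ^ 2).trans (h u)

lemma incl_injective : Function.Injective A.incl := Subtype.val_injective

lemma phaseSpace_ext {A : PosDefOperator H} {U V : A.PhaseSpace} (h₁ : U.fst = V.fst)
    (h₂ : U.snd.fst = V.snd.fst) (h₃ : U.snd.snd = V.snd.snd) : U = V :=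
  WithLp.ofLp_injective 2 (Prod.ext h₁ (WithLp.ofLp_injective 2 (Prod.ext h₂ h₃)))

lemma inner_phaseSpace (U V : A.PhaseSpace) : inner ℂ U V =
    inner ℂ (A.map U.fst) (A.map V.fst) + inner ℂ U.snd.fst V.snd.fst
      + inner ℂ U.snd.snd V.snd.snd := by
  rw [add_assoc]
  rfl

lemma inner_incl_inv (x y : H) : inner ℂ (A.incl (A.inv x)) y = inner ℂ x (A.incl (A.inv y)) := by
  conv_lhs => rw [← A.map_inv y]
  conv_rhs => rw [← A.map_inv x]
  exact (A.inner_map_incl _ _).symm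

lemma re_inner_incl_inv_nonneg (x : H) : 0 ≤ (inner ℂ x (A.incl (A.inv x))).re := by
  conv_rhs => rw [← A.map_inv x, A.inv_map]
  exact A.re_inner_map_incl_nonneg _

/-- The componentwise action of `A⁻¹` on the phase space, as a linear map. -/
def phaseInvLM : A.PhaseSpace →ₗ[ℂ] A.PhaseSpace where
  toFun U := WithLp.toLp 2 (A.inv (A.incl U.fst),
    WithLp.toLp 2 (A.incl (A.inv U.snd.fst), A.incl (A.inv U.snd.snd)))
  map_add' _ _ := by simp; rfl
  map_smul' c U := by simp; rfl

lemma phaseInvLM_isSymmetric : A.phaseInvLM.IsSymmetric := by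
  intro U V
  rw [inner_phaseSpace, inner_phaseSpace]
  have h1 : inner ℂ (A.map (A.inv (A.incl U.fst))) (A.map V.fst)
      = inner ℂ (A.map U.fst) (A.map (A.inv (A.incl V.fst))) := by
    rw [map_inv, map_inv, inner_map_incl]
  exact congrArg₂ (· + ·) (congrArg₂ (· + ·) h1 (A.inner_incl_inv _ _)) (A.inner_incl_inv _ _)

/-- The componentwise action of `A⁻¹` on the phase space, which is bounded because it is symmetric
and everywhere defined. -/
def phaseInv : A.PhaseSpace →L[ℂ] A.PhaseSpace :=
  ⟨A.phaseInvLM, A.phaseInvLM_isSymmetric.continuous⟩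

lemma phaseInv_nonneg : 0 ≤ A.phaseInv := by
  rw [ContinuousLinearMap.nonneg_iff_isPositive, ContinuousLinearMap.isPositive_def]
  refine ⟨A.phaseInvLM_isSymmetric, fun U => ?_⟩
  have h1 : 0 ≤ (inner ℂ (A.map (A.inv (A.incl U.fst))) (A.map U.fst)).re := by
    rw [map_inv, ← inner_map_incl]
    exact A.re_inner_map_incl_nonneg _
  have h2 (x : H) : 0 ≤ (inner ℂ (A.incl (A.inv x)) x).re := by
    rw [inner_incl_inv]
    exact A.re_inner_incl_inv_nonneg x
  rw [ContinuousLinearMap.reApplyInnerSelf_apply, inner_phaseSpace]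
  exact add_nonneg (add_nonneg h1 (h2 _)) (h2 _)

lemma inv_injective : Function.Injective A.inv := fun x y h => by
  rw [← A.map_inv x, h, A.map_inv]

lemma phaseInv_injective : Function.Injective A.phaseInv := fun _ _ h =>
  phaseSpace_ext (A.incl_injective (A.inv_injective (congrArg (fun W => W.fst) h)))
    (A.inv_injective (A.incl_injective (congrArg (fun W => W.snd.fst) h)))
    (A.inv_injective (A.incl_injective (congrArg (fun W => W.snd.snd) h)))

lemma denseRange_phaseInv : DenseRange A.phaseInv := by
  have hsa : IsSelfAdjoint A.phaseInv := IsSelfAdjoint.of_nonneg A.phaseInv_nonneg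
  have hbot : (A.phaseInv : A.PhaseSpace →ₗ[ℂ] A.PhaseSpace).rangeᗮ = ⊥ := by
    rw [ContinuousLinearMap.orthogonal_range, hsa.adjoint_eq, LinearMap.ker_eq_bot]
    exact A.phaseInv_injective
  have := Submodule.topologicalClosure_eq_top_iff.2 hbot
  rw [← Submodule.dense_iff_topologicalClosure_eq_top] at this
  exact this

/-- The bounded operator `(u, v, θ) ↦ (A⁻¹ v, -A u + θ, -θ - v)`. The plate operator is its product
with the componentwise action of `A`. -/
def phaseCoupling : A.PhaseSpace →L[ℂ] A.PhaseSpace where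
  toFun U := WithLp.toLp 2 (A.inv U.snd.fst,
    WithLp.toLp 2 (-A.map U.fst + U.snd.snd, -U.snd.snd - U.snd.fst))
  map_add' U V := by
    refine phaseSpace_ext (map_add A.inv _ _) ?_ ?_
    · change -A.map (U.fst + V.fst) + (U.snd.snd + V.snd.snd)
        = -A.map U.fst + U.snd.snd + (-A.map V.fst + V.snd.snd)
      rw [map_add]
      abel
    · change -(U.snd.snd + V.snd.snd) - (U.snd.fst + V.snd.fst)
        = -U.snd.snd - U.snd.fst + (-V.snd.snd - V.snd.fst)
      abel
  map_smul' c U := by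
    refine phaseSpace_ext (map_smul A.inv _ _) ?_ ?_
    · change -A.map (c • U.fst) + c • U.snd.snd = c • (-A.map U.fst + U.snd.snd)
      rw [map_smul]
      module
    · change -(c • U.snd.snd) - c • U.snd.fst = c • (-U.snd.snd - U.snd.fst)
      module
  cont := by
    have hmap : Continuous A.map :=
      AddMonoidHomClass.continuous_of_bound A.map 1 fun u => by simp [A.norm_H2]
    have hinv : Continuous A.inv :=
      AddMonoidHomClass.continuous_of_bound A.inv 1 fun x => by simp [A.norm_H2, A.map_inv]
    have h1 : Continuous fun U : A.PhaseSpace => U.fst := (WithLp.fstL 2 ℂ _ _).continuous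
    have hs : Continuous fun U : A.PhaseSpace => U.snd := (WithLp.sndL 2 ℂ _ _).continuous
    have h2 : Continuous fun U : A.PhaseSpace => U.snd.fst :=
      (WithLp.fstL 2 ℂ H H).continuous.comp hs
    have h3 : Continuous fun U : A.PhaseSpace => U.snd.snd :=
      (WithLp.sndL 2 ℂ H H).continuous.comp hs
    refine (WithLp.prod_continuous_toLp ..).comp ((hinv.comp h2).prodMk
      ((WithLp.prod_continuous_toLp ..).comp (Continuous.prodMk ?_ (h3.neg.sub h2))))
    exact (hmap.comp h1).neg.add h3

lemma commute_phaseInv_phaseCoupling : Commute A.phaseInv A.phaseCoupling := by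
  refine ContinuousLinearMap.ext fun U => phaseSpace_ext rfl ?_ ?_
  · change A.incl (A.inv (-A.map U.fst + U.snd.snd))
      = -A.map (A.inv (A.incl U.fst)) + A.incl (A.inv U.snd.snd)
    rw [map_inv, map_add, map_neg, inv_map, map_add, map_neg]
  · change A.incl (A.inv (-U.snd.snd - U.snd.fst))
      = -A.incl (A.inv U.snd.snd) - A.incl (A.inv U.snd.fst)
    rw [map_sub, map_neg, map_sub, map_neg]

/-- The Cayley-Hamilton identity for the coupling matrix `!![0, 1, 0; -1, 0, 1; 0, -1, -1]`. -/
lemma phaseCoupling_cubic : A.phaseCoupling ^ 3 + A.phaseCoupling ^ 2 + 2 * A.phaseCoupling + 1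
    = 0 := by
  refine ContinuousLinearMap.ext fun U => ?_
  rw [pow_succ, pow_succ, pow_one, two_mul]
  refine phaseSpace_ext ?_ ?_ ?_
  · change A.inv (-A.map (A.inv U.snd.fst) + (-U.snd.snd - U.snd.fst))
      + A.inv (-A.map U.fst + U.snd.snd) + (A.inv U.snd.fst + A.inv U.snd.fst) + U.fst = 0
    rw [← A.inv_map U.fst]
    simp only [map_inv, ← map_add]
    rw [← map_zero A.inv]
    congr 1
    abel
  · change -A.map (A.inv (-A.map U.fst + U.snd.snd))
        + (-(-U.snd.snd - U.snd.fst) - (-A.map U.fst + U.snd.snd))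
      + (-A.map (A.inv U.snd.fst) + (-U.snd.snd - U.snd.fst))
      + (-A.map U.fst + U.snd.snd + (-A.map U.fst + U.snd.snd)) + U.snd.fst = 0
    simp only [map_inv]
    abel
  · change -(-(-U.snd.snd - U.snd.fst) - (-A.map U.fst + U.snd.snd))
        - (-A.map (A.inv U.snd.fst) + (-U.snd.snd - U.snd.fst))
      + (-(-U.snd.snd - U.snd.fst) - (-A.map U.fst + U.snd.snd))
      + (-U.snd.snd - U.snd.fst + (-U.snd.snd - U.snd.fst)) + U.snd.snd = 0
    simp only [map_inv]
    abel

lemma incl_inv_neg_add (u v : A.H2) :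
    A.incl (A.inv (-A.map u + A.map v)) = -A.incl u + A.incl v := by
  rw [map_add, map_neg, inv_map, inv_map, map_add, map_neg]

lemma incl_inv_neg_sub (u v : A.H2) :
    A.incl (A.inv (-A.map u - A.map v)) = -A.incl u - A.incl v := by
  rw [sub_eq_add_neg, ← map_neg A.map v, incl_inv_neg_add, map_neg, sub_eq_add_neg]

/-- The plate operator is `phaseInv⁻¹ * phaseCoupling`. -/
lemma mem_graph_plate_iff (U V : A.PhaseSpace) :
    (U, V) ∈ A.plate.graph ↔ A.phaseCoupling U = A.phaseInv V := by
  constructor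
  · intro h
    obtain ⟨W, rfl, rfl⟩ := (LinearPMap.mem_graph_iff _).1 h
    refine phaseSpace_ext rfl ?_ ?_
    · exact (A.incl_inv_neg_add (A.mkH2 (A.map W.1.fst) W.2.1)
        (A.mkH2 W.1.snd.snd W.2.2.2)).symm
    · exact (A.incl_inv_neg_sub (A.mkH2 W.1.snd.snd W.2.2.2)
        (A.mkH2 W.1.snd.fst W.2.2.1)).symm
  · intro h
    have h1 : U.snd.fst = A.incl V.fst := A.inv_injective (congrArg (fun W => W.fst) h)
    have h2 : -A.map U.fst + U.snd.snd = A.incl (A.inv V.snd.fst) :=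
      congrArg (fun W => W.snd.fst) h
    have h3 : -U.snd.snd - U.snd.fst = A.incl (A.inv V.snd.snd) :=
      congrArg (fun W => W.snd.snd) h
    have hθ : U.snd.snd = A.incl (-A.inv V.snd.snd - V.fst) := by
      rw [map_sub, map_neg, ← h3, ← h1]
      abel
    have hu : A.map U.fst = A.incl (-A.inv V.snd.snd - V.fst - A.inv V.snd.fst) := by
      rw [map_sub, ← hθ, ← h2]
      abel
    have hU : U ∈ A.plate.domain :=
      ⟨hu ▸ Subtype.property _, h1 ▸ Subtype.property _, hθ ▸ Subtype.property _⟩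
    refine (LinearPMap.mem_graph_iff _).2 ⟨⟨U, hU⟩, rfl, phaseSpace_ext ?_ ?_ ?_⟩
    · exact A.incl_injective h1
    · exact A.inv_injective (A.incl_injective ((A.incl_inv_neg_add (A.mkH2 (A.map U.fst) hU.1)
        (A.mkH2 U.snd.snd hU.2.2)).trans h2))
    · exact A.inv_injective (A.incl_injective ((A.incl_inv_neg_sub (A.mkH2 U.snd.snd hU.2.2)
        (A.mkH2 U.snd.fst hU.2.1)).trans h3))

/-- The plate operator is dissipative: with `U = phaseInv Q` and `Q = (u, v, θ)` the pairing
`Re ⟪𝔸₀ U, U⟫` is `-⟪θ, A⁻¹ θ⟫`, as all the other terms cancel. -/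
lemma re_inner_phaseCoupling_phaseInv_nonpos (Q : A.PhaseSpace) :
    (inner ℂ (A.phaseCoupling Q) (A.phaseInv Q)).re ≤ 0 := by
  rw [inner_phaseSpace]
  change (inner ℂ (A.map (A.inv Q.snd.fst)) (A.map (A.inv (A.incl Q.fst)))
    + inner ℂ (-A.map Q.fst + Q.snd.snd) (A.incl (A.inv Q.snd.fst))
    + inner ℂ (-Q.snd.snd - Q.snd.fst) (A.incl (A.inv Q.snd.snd))).re ≤ 0
  have h1 : inner ℂ (A.map Q.fst) (A.incl (A.inv Q.snd.fst))
      = inner ℂ (A.incl Q.fst) Q.snd.fst := by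
    rw [inner_map_incl, map_inv]
  have h2 : (inner ℂ (A.incl Q.fst) Q.snd.fst).re = (inner ℂ Q.snd.fst (A.incl Q.fst)).re :=
    inner_re_symm (𝕜 := ℂ) _ _
  have h3 : (inner ℂ Q.snd.snd (A.incl (A.inv Q.snd.fst))).re
      = (inner ℂ Q.snd.fst (A.incl (A.inv Q.snd.snd))).re := by
    rw [← inner_incl_inv]
    exact inner_re_symm (𝕜 := ℂ) _ _
  have h4 := A.re_inner_incl_inv_nonneg Q.snd.snd
  rw [map_inv, map_inv, inner_add_left, inner_neg_left, inner_sub_left, inner_neg_left, h1]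
  simp only [Complex.add_re, Complex.sub_re, Complex.neg_re]
  linarith

end PosDefOperator

end

theorem theorem11 {H : Type*} [NormedAddCommGroup H] [InnerProductSpace ℂ H] [CompleteSpace H]
    (A : PosDefOperator H) :
    ∃ S : C0Semigroup A.PhaseSpace,
      S.HasGenerator A.plate ∧ S.IsContraction ∧
      (∀ T : C0Semigroup A.PhaseSpace, T.HasGenerator A.plate → T = S) ∧
      S.IsAnalytic := by
  obtain ⟨μ, hμ, hre, hnodal⟩ := exists_plate_eigenvalues
  have hM : Polynomial.aeval A.phaseCoupling (Lagrange.nodal Finset.univ μ) = 0 := by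
    simpa only [hnodal, map_add, map_mul, map_pow, map_ofNat, map_one, Polynomial.aeval_X]
      using A.phaseCoupling_cubic
  exact (EigenDecomposition.ofNodal μ hμ hM).exists_semigroup A.phaseInv_nonneg
    A.denseRange_phaseInv A.commute_phaseInv_phaseCoupling hre A.mem_graph_plate_iff
    A.re_inner_phaseCoupling_phaseInv_nonpos
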